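/- For $s\ge \tfrac12$ let $\kappa_s$ be the Peköz–Röllin–Ross density $$\kappa_s(x)=\Gamma(s)\sqrt{\tfrac{2}{s\pi}}\;e^{-x^2/(2s)}\,V_s(x),\qquad V_s(x)=U\Big(s-1,\tfrac12,\tfrac{x^2}{2s}\Big),\qquad x>0,$$ where $U$ is the confluent hypergeometric function of the second kind. For a function $g$ on $(0,\infty)$ put $\|g\|=\sup_{x>0}|g(x)|$ (over the points where $g$ is defined). Let $C_b^n(0,\infty)$ be the class of functions $h$ on $(0,\infty)$ such that $h^{(n-1)}$ exists everywhere and is locally absolutely continuous and all derivatives of $h$ of orders $0,\dots,n$ (that of order $n$ where it exists) are bounded; $C_b^0(0,\infty)$ consists of the bounded measurable functions. For $h\in C_b^0(0,\infty)$ write $\tilde h=h-\int_0^\infty h\,\kappa_s$ and let $$f(x)=\frac1s V_s(x)\int_0^x\frac{1}{V_s(y)\kappa_s(y)}\int_0^y\tilde h(t)\kappa_s(t)\,dt\,dy,\qquad x>0.$$ Suppose that $s=\tfrac12$ or $s\ge 1$. Then $f$ solves the PRR Stein equation $s f''(x)-xf'(x)-2(s-1)f(x)=\tilde h(x)$ for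 almost every $x>0$, and the following bounds hold. 1. If $s\ge1$, $n\ge1$ and $h\in C_b^{n-1}(0,\infty)$, then $f$ is $n$ times differentiable on $(0,\infty)$ and $$\|f^{(n)}\|\le (n-1)!\sum_{j=0}^{n-1}\frac{(2\pi)^{(n-j)/2}}{j!}\,\|h^{(j)}\|.$$ Let $C=4$ if $s=\tfrac12$ and $C=2\big(\sqrt{\pi s}+s^{-1}\big)$ if $s\ge1$, let $n\ge2$ and $h\in C_b^{n-2}(0,\infty)$. Then $f^{(n-1)}$ exists on $(0,\infty)$ and is locally absolutely continuous, and 2. if $n=2k+1$ is odd ($k\ge1$), $$\|f^{(2k+1)}\|\le\sqrt{2\pi}\,C^k(2k-1)!!\,\|h\|+\sum_{j=1}^{k}C^{k-j+1}\frac{(2k-1)!!}{(2j-1)!!}\,\|h^{(2j-1)}\|;$$ 3. if $n=2k$ is even ($k\ge1$), $$\|f^{(2k)}\|\le\sum_{j=0}^{k-1}C^{k-j+1}\frac{(2k)!!}{(2j)!!}\,\|h^{(2j)}\|.$$ -/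

import Mathlib

open Set MeasureTheory
open scoped Nat

noncomputable section

namespace PRR

/-- The integral representation of the confluent hypergeometric function of the second kind,
`U(a,b,z) = Γ(a)⁻¹ ∫₀^∞ e^{-zt} t^{a-1} (1+t)^{b-a-1} dt`, for `a > 0` and `z > 0`. -/
def confluentUIntegral (a b z : ℝ) : ℝ :=
  (Real.Gamma a)⁻¹ *
    ∫ t in Ioi (0 : ℝ), Real.exp (-z * t) * t ^ (a - 1) * (1 + t) ^ (b - a - 1)

/-- `U(a,b,z)` for `a > -N`, continued downwards in `a` by `N` applications of the contiguous
relation `U(a,b,z) = z U(a+1,b+1,z) + (a+1-b) U(a+1,b,z)`. -/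
def confluentUAux : ℕ → ℝ → ℝ → ℝ → ℝ
  | 0, a, b, z => confluentUIntegral a b z
  | N + 1, a, b, z =>
      z * confluentUAux N (a + 1) (b + 1) z + (a + 1 - b) * confluentUAux N (a + 1) b z

/-- The confluent hypergeometric function of the second kind (Tricomi's function) `U(a,b,z)`, for
real `a`, `b` and `z > 0`: the integral representation if `a > 0`, and otherwise its (unique)
continuation in `a` by the contiguous relation. -/
def confluentU (a b z : ℝ) : ℝ :=
  if 0 < a then confluentUIntegral a b z else confluentUAux (⌊-a⌋₊ + 1) a b z

/-- `V_s(x) = U(s-1, 1/2, x²/(2s))`. -/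
def V (s x : ℝ) : ℝ := confluentU (s - 1) (1 / 2) (x ^ 2 / (2 * s))

/-- The PRR density `κ_s(x) = Γ(s) √(2/(sπ)) e^{-x²/(2s)} U(s-1, 1/2, x²/(2s))`, for `x > 0`. -/
def density (s x : ℝ) : ℝ :=
  Real.Gamma s * √(2 / (s * Real.pi)) * Real.exp (-x ^ 2 / (2 * s)) * V s x

/-- `𝔼 h(Z)` for `Z` with density `κ_s` on `(0,∞)`. -/
def mean (s : ℝ) (h : ℝ → ℝ) : ℝ := ∫ x in Ioi (0 : ℝ), h x * density s x

/-- The Stein operator `L_s f(x) = s f''(x) - x f'(x) - 2(s-1) f(x)`. -/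
def steinOp (s : ℝ) (f : ℝ → ℝ) (x : ℝ) : ℝ :=
  s * iteratedDeriv 2 f x - x * deriv f x - 2 * (s - 1) * f x

/-- The solution of the Stein equation `L_s f = h - 𝔼 h(Z)` on `(0,∞)`,
`f(x) = s⁻¹ V_s(x) ∫₀^x (V_s(y) κ_s(y))⁻¹ ∫₀^y (h(t) - 𝔼 h(Z)) κ_s(t) dt dy`. -/
def steinSol (s : ℝ) (h : ℝ → ℝ) (x : ℝ) : ℝ :=
  1 / s * V s x * ∫ y in (0 : ℝ)..x,
    1 / (V s y * density s y) * ∫ t in (0 : ℝ)..y, (h t - mean s h) * density s t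

/-- `‖g‖ = sup_{x > 0} |g(x)|`. It is only used for functions that are bounded on `(0,∞)`. If `g` is
`iteratedDeriv n h` with `h ∈ C_b^n(0,∞)`, the points where `h^{(n)}` does not exist contribute `0`,
so that the supremum is the one over the points where it exists. -/
def supNorm (g : ℝ → ℝ) : ℝ := ⨆ x : Ioi (0 : ℝ), |g x|

/-- `g^{(n-1)}` exists everywhere on `(0,∞)` and is absolutely continuous on every compact interval
in `(0,∞)` (in particular `g^{(n)}` exists almost everywhere); for `n = 0`, the function `g` is
Lebesgue measurable on `(0,∞)`. -/
def HasACDeriv : ℕ → (ℝ → ℝ) → Prop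
  | 0, g => AEMeasurable g (volume.restrict (Ioi 0))
  | m + 1, g =>
      (∀ j < m, DifferentiableOn ℝ (iteratedDeriv j g) (Ioi 0)) ∧
      ∀ a ∈ Ioi (0 : ℝ), ∀ b ∈ Ioi (0 : ℝ),
        AbsolutelyContinuousOnInterval (iteratedDeriv m g) a b

/-- The class `C_b^n(0,∞)`: `h^{(n-1)}` exists and is absolutely continuous, and the derivatives
of `h` of orders `0, …, n` are bounded on `(0,∞)`, that of order `n` where it exists. -/
def MemCb (n : ℕ) (h : ℝ → ℝ) : Prop :=
  HasACDeriv n h ∧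
    ∀ j ≤ n, ∃ M : ℝ, ∀ x ∈ Ioi (0 : ℝ), |iteratedDeriv j h x| ≤ M

/-- The constant `C`: `4` if `s = 1/2`, and `2(√(πs) + 1/s)` if `s ≥ 1`. -/
def constC (s : ℝ) : ℝ := if s = 1 / 2 then 4 else 2 * (√(Real.pi * s) + 1 / s)

end PRR

end

noncomputable section

namespace PRR

open Filter Topology

/-! The function V_s solves the homogeneous equation s V'' = x V' + 2(s-1) V, which is Kummer's
equation for U in the variable x²/(2s), and κ_s is a constant times e^{-x²/(2s)} V_s. Hence f is the
solution given by variation of constants. Differentiating the Stein equation j times gives an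
equation of the same type, s f^{(j+2)} = x f^{(j+1)} + (2s-2+j) f^{(j)} + h^{(j)}, with h centred
when j = 0. The regularity of h therefore passes to f with two derivatives gained (`SteinRegular`).

All bounds come from a bound r on the residual s f^{(n+2)} - x f^{(n+1)}. With the integrating
factor e^{-x²/(2s)} this is a first-order equation for f^{(n+1)}. If f^{(n)} grows at most linearly,
the homogeneous solution e^{x²/(2s)} is excluded, and the Mills ratio yields |f^{(n+1)}| ≤
(r/s)√(2πs)/2 and x|f^{(n+1)}| ≤ r. The latter gives |f^{(n+2)}| ≤ 2r/s (`abs_le_of_growth`,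
`SteinRegular.abs_le`).

For s ≥ 1 the residual is h^{(n)} + c f^{(n)} with c = 2s-2+n ≥ 0. When c > 0, a maximum principle
(`le_of_maximum_principle`) bounds c|f^{(n)}| by the larger of sup|h^{(n)}| and the boundary value
at 0+. Since f and f' tend to 0 at 0, letting x → 0 in the differentiated equations controls the
boundary values by a recursion of step two (`boundaryBound`), which separates even from odd orders.
What remains is to compare this recursion with the claimed sums.

For s = 1/2 one has c = n-1, negative at n = 0, where the maximum principle is lost. There V_s(x) =
x, and x f' - f is explicit and bounded, which bounds f''. From then on f^{(n)} bounds f^{(n+2)}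
directly. The odd orders start at n = 1, where c vanishes. -/

/-- Local absolute continuity on `(0,∞)`. -/
def LocAC (u : ℝ → ℝ) : Prop :=
  ∀ a ∈ Ioi (0 : ℝ), ∀ b ∈ Ioi (0 : ℝ), AbsolutelyContinuousOnInterval u a b

lemma uIcc_subset_Ioi_zero {a b : ℝ} (ha : 0 < a) (hb : 0 < b) : uIcc a b ⊆ Ioi 0 :=
  fun _ hx => lt_of_lt_of_le (lt_min ha hb) hx.1

/-! ### Calculus of locally absolutely continuous functions on (0,∞). -/

namespace LocAC

variable {u v : ℝ → ℝ}

lemma add (hu : LocAC u) (hv : LocAC v) : LocAC fun x => u x + v x :=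
  fun a ha b hb => (hu a ha b hb).fun_add (hv a ha b hb)

lemma sub (hu : LocAC u) (hv : LocAC v) : LocAC fun x => u x - v x :=
  fun a ha b hb => (hu a ha b hb).fun_sub (hv a ha b hb)

lemma neg (hu : LocAC u) : LocAC fun x => -u x :=
  fun a ha b hb => (hu a ha b hb).fun_neg

lemma mul (hu : LocAC u) (hv : LocAC v) : LocAC fun x => u x * v x :=
  fun a ha b hb => (hu a ha b hb).fun_mul (hv a ha b hb)

lemma const_mul (c : ℝ) (hu : LocAC u) : LocAC fun x => c * u x :=
  fun a ha b hb => (hu a ha b hb).const_mul c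

lemma continuousOn (hu : LocAC u) : ContinuousOn u (Ioi 0) := by
  intro x hx
  have hx0 : 0 < x := hx
  have h := (hu (x / 2) (half_pos hx0) (2 * x) (by simpa using hx0)).continuousOn
  rw [uIcc_of_le (by linarith)] at h
  exact (h.continuousAt (Icc_mem_nhds (by linarith) (by linarith))).continuousWithinAt

lemma congr (hu : LocAC u) (h : ∀ x, 0 < x → u x = v x) : LocAC v := by
  intro a ha b hb
  have hab := hu a ha b hb
  rw [absolutelyContinuousOnInterval_iff] at hab ⊢
  intro ε hε
  obtain ⟨δ, hδ, H⟩ := hab ε hε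
  refine ⟨δ, hδ, fun E hE hEδ => ?_⟩
  convert H E hE hEδ using 1
  refine Finset.sum_congr rfl fun i hi => ?_
  rw [h _ (uIcc_subset_Ioi_zero ha hb (hE.1 i hi).1), h _ (uIcc_subset_Ioi_zero ha hb (hE.1 i hi).2)]

lemma ae_differentiableAt (hu : LocAC u) : ∀ᵐ x, 0 < x → DifferentiableAt ℝ u x := by
  have h : ∀ n : ℕ, ∀ᵐ x, x ∈ uIcc (1 / ((n : ℝ) + 1)) ((n : ℝ) + 1) → DifferentiableAt ℝ u x :=
    fun n => (hu _ (by simp only [mem_Ioi]; positivity) _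
      (by simp only [mem_Ioi]; positivity)).ae_differentiableAt
  filter_upwards [ae_all_iff.2 h] with x hx hx0
  obtain ⟨n, hn⟩ := exists_nat_gt (max x (1 / x))
  have h1 : x < n := (le_max_left _ _).trans_lt hn
  have h2 : 1 / x < n := (le_max_right _ _).trans_lt hn
  refine hx n (mem_uIcc_of_le ?_ (by linarith))
  rw [div_le_iff₀ (by positivity)]
  rw [div_lt_iff₀ hx0] at h2
  nlinarith

lemma of_bounded_deriv (hu : ∀ x, 0 < x → DifferentiableAt ℝ u x)
    (hb : ∀ a b, 0 < a → 0 < b → ∃ M : ℝ, ∀ x ∈ uIcc a b, |deriv u x| ≤ M) : LocAC u := by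
  intro a ha b hb'
  obtain ⟨M, hM⟩ := hb a b ha hb'
  have hM0 : 0 ≤ M := (abs_nonneg _).trans (hM a left_mem_uIcc)
  refine LipschitzOnWith.absolutelyContinuousOnInterval (K := M.toNNReal) ?_
  refine (convex_uIcc a b).lipschitzOnWith_of_nnnorm_deriv_le
    (fun x hx => hu x (uIcc_subset_Ioi_zero ha hb' hx)) fun x hx => ?_
  rw [← NNReal.coe_le_coe, coe_nnnorm, Real.coe_toNNReal M hM0]
  exact hM x hx

lemma of_hasDerivAt (hu : ∀ x, 0 < x → HasDerivAt u (v x) x) (hv : ContinuousOn v (Ioi 0)) :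
    LocAC u := by
  refine of_bounded_deriv (fun x hx => (hu x hx).differentiableAt) fun a b ha hb => ?_
  obtain ⟨M, hM⟩ := isCompact_uIcc.exists_bound_of_continuousOn
    (hv.mono (uIcc_subset_Ioi_zero ha hb))
  exact ⟨M, fun x hx => by
    rw [(hu x (uIcc_subset_Ioi_zero ha hb hx)).deriv]; exact hM x hx⟩

lemma le_sub_of_le_deriv (hu : LocAC u) {p : ℝ → ℝ} {a b : ℝ} (ha : 0 < a) (hab : a ≤ b)
    (hp : IntervalIntegrable p volume a b) (h : ∀ᵐ x, x ∈ Ioc a b → p x ≤ deriv u x) :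
    ∫ x in a..b, p x ≤ u b - u a := by
  have hac := hu a ha b (ha.trans_le hab)
  rw [← hac.integral_deriv_eq_sub]
  refine intervalIntegral.integral_mono_ae_restrict hab hp hac.intervalIntegrable_deriv ?_
  rw [EventuallyLE, ae_restrict_iff' measurableSet_Icc]
  have h0 : ∀ᵐ x : ℝ, x ≠ a := by simp [ae_iff, measure_singleton]
  filter_upwards [h, h0] with x hx hx0 hx1
  exact hx ⟨lt_of_le_of_ne hx1.1 (Ne.symm hx0), hx1.2⟩

lemma abs_sub_le_of_abs_deriv_le (hu : LocAC u) {K : ℝ} (h : ∀ᵐ x, 0 < x → |deriv u x| ≤ K)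
    {a b : ℝ} (ha : 0 < a) (hb : 0 < b) : |u b - u a| ≤ K * |b - a| := by
  rw [← (hu a ha b hb).integral_deriv_eq_sub]
  refine intervalIntegral.norm_integral_le_of_norm_le_const_ae (f := deriv u) ?_
  filter_upwards [h] with x hx hx1
  exact hx ((lt_min ha hb).trans hx1.1)

/-- An almost everywhere bound on the derivative makes u Lipschitz on (0,∞), so the bound holds at
every point; where u is not differentiable, `deriv` is 0. This turns a.e. information from the Stein
equation into bounds on the top derivative valid everywhere. -/
lemma abs_deriv_le (hu : LocAC u) {K : ℝ} (h : ∀ᵐ x, 0 < x → |deriv u x| ≤ K) {x : ℝ}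
    (hx : 0 < x) : |deriv u x| ≤ K := by
  have hK : 0 ≤ K := by
    have := hu.abs_sub_le_of_abs_deriv_le h one_pos two_pos
    norm_num at this
    exact (abs_nonneg _).trans this
  rw [← Real.coe_toNNReal K hK]
  refine norm_deriv_le_of_lipschitzOn (f := u) (Ioi_mem_nhds hx) ?_
  refine LipschitzOnWith.of_dist_le_mul fun y hy z hz => ?_
  rw [Real.coe_toNNReal K hK]
  exact hu.abs_sub_le_of_abs_deriv_le h hz hy

/-- A locally absolutely continuous function whose derivative agrees a.e. with a continuous
function is differentiable with that derivative. -/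
lemma hasDerivAt_of_ae_eq (hu : LocAC u) (hv : ContinuousOn v (Ioi 0))
    (h : ∀ᵐ x, 0 < x → deriv u x = v x) {x : ℝ} (hx : 0 < x) : HasDerivAt u (v x) x := by
  have key : ∀ y, 0 < y → u y = u x + ∫ t in x..y, v t := by
    intro y hy
    have := (hu x hx y hy).integral_deriv_eq_sub
    rw [← sub_eq_iff_eq_add', ← this]
    refine intervalIntegral.integral_congr_ae ?_
    filter_upwards [h] with t ht ht1
    exact ht ((lt_min hx hy).trans ht1.1)
  have hd : HasDerivAt (fun y => u x + ∫ t in x..y, v t) (v x) x := by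
    refine HasDerivAt.const_add _ ?_
    refine intervalIntegral.integral_hasDerivAt_right (by simp) ?_
      (hv.continuousAt (Ioi_mem_nhds hx))
    exact hv.stronglyMeasurableAtFilter isOpen_Ioi x hx
  refine hd.congr_of_eventuallyEq ?_
  filter_upwards [Ioi_mem_nhds hx] with y hy using key y hy

end LocAC

/-! ### Gaussian tails and the Mills ratio. -/

lemma hasDerivAt_gauss (s x : ℝ) : HasDerivAt (fun y : ℝ => Real.exp (-y ^ 2 / (2 * s)))
    (-(x / s) * Real.exp (-x ^ 2 / (2 * s))) x := by
  have h := (((hasDerivAt_pow 2 x).fun_neg).div_const (2 * s)).exp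
  convert h using 1
  rcases eq_or_ne s 0 with rfl | hs
  · simp
  · field_simp
    simp [mul_comm]

lemma locAC_gauss (s : ℝ) : LocAC fun y : ℝ => Real.exp (-y ^ 2 / (2 * s)) :=
  LocAC.of_hasDerivAt (fun x _ => hasDerivAt_gauss s x) (by fun_prop)

lemma gauss_eq (s x : ℝ) : Real.exp (-x ^ 2 / (2 * s)) = Real.exp (-(1 / (2 * s)) * x ^ 2) := by
  congr 1; ring

lemma integrableOn_gauss {s : ℝ} (hs : 0 < s) (a : ℝ) :
    IntegrableOn (fun y : ℝ => Real.exp (-y ^ 2 / (2 * s))) (Ioi a) := by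
  simp_rw [gauss_eq]
  exact (integrable_exp_neg_mul_sq (by positivity)).integrableOn

lemma integral_gauss_Ioi_zero {s : ℝ} (hs : 0 < s) :
    ∫ y in Ioi (0 : ℝ), Real.exp (-y ^ 2 / (2 * s)) = √(2 * Real.pi * s) / 2 := by
  simp_rw [gauss_eq]
  rw [integral_gaussian_Ioi]
  congr 2
  field_simp

/-- Shift the tail to (0,∞) and use (y+x)² ≥ y² + x². The bound is sharp at x = 0 and produces the
factor √(2πs)/2. -/
lemma integral_gauss_Ioi_le {s : ℝ} (hs : 0 < s) {x : ℝ} (hx : 0 ≤ x) :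
    ∫ y in Ioi x, Real.exp (-y ^ 2 / (2 * s)) ≤
      Real.exp (-x ^ 2 / (2 * s)) * (√(2 * Real.pi * s) / 2) := by
  have h1 : ∫ y in Ioi x, Real.exp (-y ^ 2 / (2 * s)) =
      ∫ y in Ioi (0 : ℝ), Real.exp (-(y + x) ^ 2 / (2 * s)) := by
    have := (measurePreserving_add_right volume x).setIntegral_preimage_emb
      (measurableEmbedding_addRight x) (fun y : ℝ => Real.exp (-y ^ 2 / (2 * s))) (Ioi x)
    simpa using this.symm
  rw [h1, ← integral_gauss_Ioi_zero hs, ← integral_const_mul]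
  refine setIntegral_mono_on ?_ ((integrableOn_gauss hs 0).const_mul _) measurableSet_Ioi
    fun y hy => ?_
  · have := (integrable_exp_neg_mul_sq (b := 1 / (2 * s)) (by positivity)).comp_add_right x
    simp_rw [gauss_eq]
    exact this.integrableOn
  · rw [← Real.exp_add]
    refine Real.exp_le_exp.2 ?_
    rw [← add_div]
    refine div_le_div_of_nonneg_right ?_ (by positivity)
    have : 0 ≤ y * x := mul_nonneg (le_of_lt hy) hx
    nlinarith

lemma tendsto_gauss_atTop {s : ℝ} (hs : 0 < s) :
    Tendsto (fun y : ℝ => Real.exp (-y ^ 2 / (2 * s))) atTop (𝓝 0) := by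
  refine Real.tendsto_exp_atBot.comp ?_
  refine Tendsto.atBot_div_const (by positivity) ?_
  exact tendsto_neg_atTop_atBot.comp (tendsto_pow_atTop two_ne_zero)

/-- The upper tail of `t e^{-t²/(2s)}`. -/
lemma integral_mul_gauss_Ioi {s : ℝ} (hs : 0 < s) {x : ℝ} (hx : 0 ≤ x) :
    IntegrableOn (fun y : ℝ => y * Real.exp (-y ^ 2 / (2 * s))) (Ioi x) ∧
    ∫ y in Ioi x, y * Real.exp (-y ^ 2 / (2 * s)) = s * Real.exp (-x ^ 2 / (2 * s)) := by
  have hd : ∀ y ∈ Ioi x, HasDerivAt (fun y : ℝ => -s * Real.exp (-y ^ 2 / (2 * s)))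
      (y * Real.exp (-y ^ 2 / (2 * s))) y := fun y _ => by
    refine ((hasDerivAt_gauss s y).const_mul (-s)).congr_deriv ?_
    field_simp
  have ht : Tendsto (fun y : ℝ => -s * Real.exp (-y ^ 2 / (2 * s))) atTop (𝓝 0) := by
    simpa using (tendsto_gauss_atTop hs).const_mul (-s)
  have hc : ContinuousWithinAt (fun y : ℝ => -s * Real.exp (-y ^ 2 / (2 * s))) (Ici x) x :=
    Continuous.continuousWithinAt (by fun_prop)
  have hp : ∀ y ∈ Ioi x, 0 ≤ y * Real.exp (-y ^ 2 / (2 * s)) := fun y hy =>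
    mul_nonneg (hx.trans (le_of_lt hy)) (Real.exp_pos _).le
  refine ⟨integrableOn_Ioi_deriv_of_nonneg hc hd hp ht, ?_⟩
  rw [integral_Ioi_of_hasDerivAt_of_nonneg hc hd hp ht]
  ring

/-- On the tail x ≤ y, and y e^{-y²/(2s)} has an explicit antiderivative. This is the Mills bound
for large x. -/
lemma mul_integral_gauss_Ioi_le {s : ℝ} (hs : 0 < s) {x : ℝ} (hx : 0 ≤ x) :
    x * ∫ y in Ioi x, Real.exp (-y ^ 2 / (2 * s)) ≤ s * Real.exp (-x ^ 2 / (2 * s)) := by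
  obtain ⟨hi, he⟩ := integral_mul_gauss_Ioi hs hx
  rw [← he, ← integral_const_mul]
  refine setIntegral_mono_on ((integrableOn_gauss hs x).const_mul _) hi measurableSet_Ioi
    fun y hy => ?_
  exact mul_le_mul_of_nonneg_right (le_of_lt hy) (Real.exp_pos _).le

/-! ### Comparison and maximum principles with an almost everywhere second derivative. -/

lemma LocAC.ae_deriv_mul_gauss {u : ℝ → ℝ} (hu : LocAC u) {s : ℝ} (hs : 0 < s) :
    ∀ᵐ x, 0 < x → deriv (fun y => u y * Real.exp (-y ^ 2 / (2 * s))) x =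
      (s * deriv u x - x * u x) / s * Real.exp (-x ^ 2 / (2 * s)) := by
  filter_upwards [hu.ae_differentiableAt] with x hx hx0
  rw [((hx hx0).hasDerivAt.fun_mul (hasDerivAt_gauss s x)).deriv]
  field_simp
  ring

/-- If `s u' - x u ≥ -r` and `u` is the derivative of a function of at most linear growth, then `u`
is bounded above by `r/s` times the Mills ratio. -/
lemma le_mills_of_growth {s r A B : ℝ} (hs : 0 < s) (hr : 0 ≤ r) {g u : ℝ → ℝ}
    (hg : ∀ x, 0 < x → HasDerivAt g (u x) x) (hu : LocAC u)
    (hR : ∀ᵐ x, 0 < x → -r ≤ s * deriv u x - x * u x)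
    (hgrow : ∀ x, 0 < x → g x ≤ A + B * x) {x : ℝ} (hx : 0 < x) :
    u x * Real.exp (-x ^ 2 / (2 * s)) ≤ r / s * ∫ y in Ioi x, Real.exp (-y ^ 2 / (2 * s)) := by
  set E : ℝ → ℝ := fun y => Real.exp (-y ^ 2 / (2 * s)) with hE
  by_contra! hlt
  -- δ is the excess over the claimed bound. The weighted function u E can lose at most the
  -- remaining tail to the right of x, so it stays at least δ and u grows at least like δ
  -- e^{y²/(2s)}. Then g grows faster than linearly, a contradiction.
  set δ : ℝ := u x * E x - r / s * ∫ y in Ioi x, E y with hδ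
  have hδ0 : 0 < δ := sub_pos.2 hlt
  have hw : ∀ y, x ≤ y → δ ≤ u y * E y := by
    intro y hy
    have h1 := (hu.mul (locAC_gauss s)).le_sub_of_le_deriv (p := fun t => -(r / s) * E t) hx hy
      (Continuous.intervalIntegrable (by fun_prop) _ _) (by
        filter_upwards [hR, hu.ae_deriv_mul_gauss hs] with t ht1 ht2 ht
        have ht0 : 0 < t := hx.trans ht.1
        rw [ht2 ht0]
        refine mul_le_mul_of_nonneg_right ?_ (Real.exp_pos _).le
        rw [← neg_div]
        exact div_le_div_of_nonneg_right (ht1 ht0) hs.le)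
    rw [intervalIntegral.integral_const_mul, intervalIntegral.integral_of_le hy] at h1
    have h2 : ∫ t in Ioc x y, E t ≤ ∫ t in Ioi x, E t :=
      setIntegral_mono_set (integrableOn_gauss hs x) (ae_of_all _ fun t => (Real.exp_pos _).le)
        Ioc_subset_Ioi_self.eventuallyLE
    have h3 := mul_le_mul_of_nonneg_left h2 (div_nonneg hr hs.le)
    simp only [hδ]
    change -(r / s) * _ ≤ u y * E y - u x * E x at h1
    linarith
  have hu2 : ∀ y, x ≤ y → δ * (y ^ 2 / (2 * s)) ≤ u y := by
    intro y hy
    have h1 := hw y hy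
    have h2 : y ^ 2 / (2 * s) ≤ Real.exp (y ^ 2 / (2 * s)) := by
      linarith [Real.add_one_le_exp (y ^ 2 / (2 * s))]
    have h3 : E y * Real.exp (y ^ 2 / (2 * s)) = 1 := by
      rw [hE, ← Real.exp_add, neg_div, neg_add_cancel, Real.exp_zero]
    calc δ * (y ^ 2 / (2 * s)) ≤ δ * Real.exp (y ^ 2 / (2 * s)) := by gcongr
      _ ≤ u y * E y * Real.exp (y ^ 2 / (2 * s)) := by gcongr
      _ = u y := by rw [mul_assoc, h3, mul_one]
  -- Beyond this point the quadratic lower bound on u exceeds B + 1, one more than the slope allowed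
  -- to g.
  set y0 : ℝ := max x (max 1 (2 * s * (B + 1) / δ)) with hy0
  have hxy : x ≤ y0 := le_max_left _ _
  have hy01 : 1 ≤ y0 := (le_max_left _ _).trans (le_max_right _ _)
  have hy02 : 2 * s * (B + 1) / δ ≤ y0 := (le_max_right _ _).trans (le_max_right _ _)
  have hu3 : ∀ y, y0 ≤ y → B + 1 ≤ u y := by
    intro y hy
    refine le_trans ?_ (hu2 y (hxy.trans hy))
    rw [mul_div_assoc', le_div_iff₀ (by positivity)]
    rw [div_le_iff₀ hδ0] at hy02
    have : y0 ≤ y ^ 2 := by nlinarith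
    nlinarith
  have hmono : MonotoneOn (fun y => g y - (B + 1) * y) (Ici y0) := by
    have hd : ∀ y, y0 ≤ y → HasDerivAt (fun y => g y - (B + 1) * y) (u y - (B + 1) * 1) y :=
      fun y hy => (hg y (by linarith)).sub ((hasDerivAt_id y).const_mul _)
    refine monotoneOn_of_deriv_nonneg (convex_Ici _)
      (fun y hy => (hd y hy).continuousAt.continuousWithinAt)
      (fun y hy => (hd y (interior_subset hy)).differentiableAt.differentiableWithinAt)
      fun y hy => ?_
    rw [(hd y (interior_subset hy)).deriv]
    linarith [hu3 y (interior_subset hy)]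
  -- Far enough that the surplus slope 1 overtakes the constants A, g(y0) and (B+1) y0.
  set y1 : ℝ := y0 + |A - g y0 + (B + 1) * y0| + 1 with hy1
  have hy01' : y0 ≤ y1 := by linarith [abs_nonneg (A - g y0 + (B + 1) * y0)]
  have h1 := hmono (self_mem_Ici (a := y0)) hy01' hy01'
  have h2 := hgrow y1 (by linarith)
  have h3 := le_abs_self (A - g y0 + (B + 1) * y0)
  simp only at h1
  nlinarith

/-- Bounds on `u` when `|s u' - x u| ≤ r` and `u` is the derivative of a function of at most linear
growth. -/
lemma abs_le_of_growth {s r A B : ℝ} (hs : 0 < s) {g u : ℝ → ℝ}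
    (hg : ∀ x, 0 < x → HasDerivAt g (u x) x) (hu : LocAC u)
    (hR : ∀ᵐ x, 0 < x → |s * deriv u x - x * u x| ≤ r)
    (hgrow : ∀ x, 0 < x → |g x| ≤ A + B * x) {x : ℝ} (hx : 0 < x) :
    |u x| ≤ r / s * (√(2 * Real.pi * s) / 2) ∧ x * |u x| ≤ r := by
  -- The residual bound holds only a.e., so nonnegativity of r needs a point of (0,∞) outside the
  -- null set.
  have hr : 0 ≤ r := by
    have h0 : ∃ᵐ x : ℝ, 0 < x := by
      intro h
      have : volume (Ioi (0 : ℝ)) = 0 := by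
        simpa [ae_iff, Ioi] using h
      simp at this
    obtain ⟨y, hy1, hy2⟩ := (h0.and_eventually hR).exists
    exact (abs_nonneg _).trans (hy2 hy1)
  have h1 := le_mills_of_growth hs hr hg hu
    (by filter_upwards [hR] with y hy hy0 using (abs_le.1 (hy hy0)).1)
    (fun y hy => (le_abs_self _).trans (hgrow y hy)) hx
  have h2 := le_mills_of_growth (g := fun y => -g y) (u := fun y => -u y) hs hr
    (fun y hy => (hg y hy).neg) hu.neg
    (by
      filter_upwards [hR] with y hy hy0
      rw [deriv.fun_neg]
      linarith [(abs_le.1 (hy hy0)).2])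
    (fun y hy => (neg_le_abs _).trans (hgrow y hy)) hx
  have hEx : 0 < Real.exp (-x ^ 2 / (2 * s)) := Real.exp_pos _
  have h3 : |u x| * Real.exp (-x ^ 2 / (2 * s)) ≤
      r / s * ∫ y in Ioi x, Real.exp (-y ^ 2 / (2 * s)) := by
    rcases abs_cases (u x) with ⟨h, -⟩ | ⟨h, -⟩ <;> rw [h] <;> assumption
  have hrs : 0 ≤ r / s := div_nonneg hr hs.le
  constructor
  · refine le_of_mul_le_mul_right (h3.trans ?_) hEx
    calc _ ≤ r / s * (Real.exp (-x ^ 2 / (2 * s)) * (√(2 * Real.pi * s) / 2)) :=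
          mul_le_mul_of_nonneg_left (integral_gauss_Ioi_le hs hx.le) hrs
      _ = _ := by ring
  · refine le_of_mul_le_mul_right ?_ hEx
    calc x * |u x| * Real.exp (-x ^ 2 / (2 * s))
        = x * (|u x| * Real.exp (-x ^ 2 / (2 * s))) := by ring
      _ ≤ x * (r / s * ∫ y in Ioi x, Real.exp (-y ^ 2 / (2 * s))) := by gcongr
      _ = r / s * (x * ∫ y in Ioi x, Real.exp (-y ^ 2 / (2 * s))) := by ring
      _ ≤ r / s * (s * Real.exp (-x ^ 2 / (2 * s))) :=
          mul_le_mul_of_nonneg_left (mul_integral_gauss_Ioi_le hs hx.le) hrs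
      _ = _ := by field_simp

/-- A maximum principle on `(0,∞)` for the operator `s g'' - x g' - c g`, `c > 0`. -/
lemma le_of_maximum_principle {s c r d A B : ℝ} (hs : 0 < s) (hc : 0 < c) (hrd : r ≤ c * d)
    (hA : 0 ≤ A) (hd0 : 0 ≤ d) {g u : ℝ → ℝ}
    (hg : ∀ x, 0 < x → HasDerivAt g (u x) x) (hu : LocAC u)
    (hR : ∀ᵐ x, 0 < x → -r ≤ s * deriv u x - x * u x - c * g x)
    (hgrow : ∀ x, 0 < x → g x ≤ A + B * x)
    (hzero : ∀ ε > 0, ∀ᶠ x in 𝓝[>] (0 : ℝ), g x ≤ d + ε) {x : ℝ} (hx : 0 < x) : g x ≤ d := by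
  -- With cK = 2s + c, the operator sends y² + K to -(2+c) y² - c ≤ -c. Subtracting ε(y² + K) from g
  -- thus makes the differential inequality strict by εc, and also forces the perturbed function
  -- below d at infinity.
  set K : ℝ := 2 * s / c + 1 with hK
  have hK0 : 0 < K := by positivity
  have hcK : c * K = 2 * s + c := by rw [hK]; field_simp
  suffices h : ∀ ε > 0, g x - ε * (x ^ 2 + K) ≤ d by
    refine le_of_forall_pos_le_add fun ε hε => ?_
    have := h (ε / (x ^ 2 + K)) (by positivity)
    rw [div_mul_cancel₀ _ (by positivity)] at this
    linarith
  intro ε hε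
  by_contra! hcon
  set p : ℝ → ℝ := fun y => g y - ε * (y ^ 2 + K) with hp
  set q : ℝ → ℝ := fun y => u y - ε * (2 * y) with hq
  have hpder : ∀ y, 0 < y → HasDerivAt p (q y) y := fun y hy => by
    refine (hg y hy).sub ?_
    simpa using (((hasDerivAt_id y).pow 2).add_const K).const_mul ε
  have hqac : LocAC q := hu.sub
    (LocAC.of_hasDerivAt (v := fun _ => ε * 2)
      (fun y _ => by simpa using ((hasDerivAt_id y).const_mul 2).const_mul ε) continuousOn_const)
  -- near zero and near infinity `p` is at most `d`
  obtain ⟨δ, hδ0, hδ⟩ : ∃ δ > 0, ∀ y, 0 < y → y ≤ δ → p y ≤ d := by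
    have := hzero (ε * K) (by positivity)
    rw [eventually_nhdsWithin_iff, Metric.eventually_nhds_iff] at this
    obtain ⟨δ, hδ, h⟩ := this
    refine ⟨δ / 2, by positivity, fun y hy hyd => ?_⟩
    have h1 := h (y := y) (by rw [Real.dist_eq, sub_zero, abs_of_pos hy]; linarith) hy
    simp only [hp]
    nlinarith [sq_nonneg y, mul_nonneg hε.le (sq_nonneg y)]
  obtain ⟨X, hX⟩ : ∃ X, ∀ y, X ≤ y → p y ≤ d := by
    -- For y ≥ 1 and y ≥ (A+B)/ε, the growth bound satisfies A + By ≤ (A+B) y ≤ ε y².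
    refine ⟨max 1 ((A + B) / ε), fun y hy => ?_⟩
    have hy1 : 1 ≤ y := (le_max_left _ _).trans hy
    have hy2 : (A + B) / ε ≤ y := (le_max_right _ _).trans hy
    rw [div_le_iff₀ hε] at hy2
    have h1 := hgrow y (by linarith)
    have h2 : A + B * y ≤ ε * y ^ 2 := by nlinarith
    simp only [hp]
    nlinarith [mul_pos hε hK0]
  have hxδ : δ < x := by
    by_contra! h
    exact absurd (hδ x hx h) (not_le.2 hcon)
  have hxX : x < X := by
    by_contra! h
    exact absurd (hX x h) (not_le.2 hcon)
  obtain ⟨x0, hx0m, hx0⟩ := isCompact_Icc.exists_isMaxOn (s := Icc δ X) (f := p)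
    ⟨x, hxδ.le, hxX.le⟩
    (fun y hy => (hpder y (hδ0.trans_le hy.1)).continuousAt.continuousWithinAt)
  have hpx0 : d < p x0 := hcon.trans_le (hx0 ⟨hxδ.le, hxX.le⟩)
  have h1 : δ < x0 := lt_of_le_of_ne hx0m.1 (by
    rintro rfl
    exact absurd (hδ _ hδ0 le_rfl) (not_le.2 hpx0))
  have h2 : x0 < X := lt_of_le_of_ne hx0m.2 (by
    rintro rfl
    exact absurd (hX _ le_rfl) (not_le.2 hpx0))
  have hx00 : 0 < x0 := hδ0.trans h1
  have hq0 : q x0 = 0 :=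
    (hx0.isLocalMax (Icc_mem_nhds h1 h2)).hasDerivAt_eq_zero (hpder x0 hx00)
  obtain ⟨η, hη0, hη⟩ : ∃ η > 0, ∀ y ∈ Icc x0 (x0 + η), d < p y ∧ y ≤ X := by
    have h3 : ∀ᶠ y in 𝓝 x0, d < p y ∧ y ≤ X :=
      ((hpder x0 hx00).continuousAt.eventually_const_lt hpx0).and (eventually_le_nhds h2)
    obtain ⟨η, hη, h⟩ := Metric.eventually_nhds_iff.1 h3
    refine ⟨η / 2, by positivity, fun y hy => h ?_⟩
    rw [Real.dist_eq, abs_of_nonneg (by linarith [hy.1])]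
    linarith [hy.2]
  -- The second derivative exists only a.e., so the second-derivative test at the maximum x0 is
  -- unavailable. Instead, just to the right of x0 one still has p > d, hence s q' - t q ≥ εc a.e.;
  -- integrating (q E)' from q(x0) = 0 gives q > 0, so p increases past its maximum.
  have hqpos : ∀ y ∈ Ioc x0 (x0 + η), 0 < q y := by
    intro y hy
    have h3 := (hqac.mul (locAC_gauss s)).le_sub_of_le_deriv
      (p := fun t => ε * c / s * Real.exp (-t ^ 2 / (2 * s))) hx00 hy.1.le
      (Continuous.intervalIntegrable (by fun_prop) _ _) (by
        filter_upwards [hR, hqac.ae_deriv_mul_gauss hs, hu.ae_differentiableAt]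
          with t ht1 ht2 ht3 ht
        have ht0 : 0 < t := hx00.trans ht.1
        rw [ht2 ht0]
        refine mul_le_mul_of_nonneg_right ?_ (Real.exp_pos _).le
        refine div_le_div_of_nonneg_right ?_ hs.le
        have h4 : deriv q t = deriv u t - ε * 2 := by
          refine ((ht3 ht0).hasDerivAt.sub ?_).deriv
          simpa using ((hasDerivAt_id t).const_mul 2).const_mul ε
        have h5 := (hη t ⟨ht.1.le, ht.2.trans hy.2⟩).1
        have h6 := ht1 ht0
        rw [h4]
        simp only [hq]
        simp only [hp] at h5
        have h7 := mul_lt_mul_of_pos_left h5 hc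
        have h8 : c * (ε * (t ^ 2 + K)) = ε * (c * t ^ 2 + (2 * s + c)) := by rw [← hcK]; ring
        have h9 : 0 ≤ ε * (t ^ 2) := by positivity
        have h10 : 0 ≤ ε * (c * t ^ 2) := by positivity
        nlinarith)
    have h4 : 0 < ∫ t in x0..y, ε * c / s * Real.exp (-t ^ 2 / (2 * s)) :=
      intervalIntegral.intervalIntegral_pos_of_pos
        (Continuous.intervalIntegrable (by fun_prop) _ _) (fun t => by positivity) hy.1
    rw [hq0] at h3
    have h5 : 0 < q y * Real.exp (-y ^ 2 / (2 * s)) := by linarith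
    exact pos_of_mul_pos_left h5 (Real.exp_pos _).le
  have hmono : StrictMonoOn p (Icc x0 (x0 + η)) := by
    refine strictMonoOn_of_deriv_pos (convex_Icc _ _)
      (fun y hy => (hpder y (hx00.trans_le hy.1)).continuousAt.continuousWithinAt) fun y hy => ?_
    rw [interior_Icc] at hy
    rw [(hpder y (hx00.trans hy.1)).deriv]
    exact hqpos y ⟨hy.1, hy.2.le⟩
  have h3 := hmono ⟨le_rfl, by linarith⟩ ⟨by linarith, le_rfl⟩ (by linarith : x0 < x0 + η)
  have h4 := hx0 (a := x0 + η) ⟨by linarith, (hη (x0 + η) ⟨by linarith, le_rfl⟩).2⟩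
  exact absurd h4 (not_le.2 h3)

/-! ### Laplace integrals and Kummer's equation. -/

/-- The Laplace-type integral `∫₀^∞ e^{-zt} t^p (1+t)^q dt`. -/
def laplaceInt (p q z : ℝ) : ℝ :=
  ∫ t in Ioi (0 : ℝ), Real.exp (-z * t) * t ^ p * (1 + t) ^ q

lemma integrableOn_exp_mul_rpow {p z : ℝ} (hp : -1 < p) (hz : 0 < z) :
    IntegrableOn (fun t : ℝ => Real.exp (-z * t) * t ^ p) (Ioi 0) := by
  have h := integrableOn_rpow_mul_exp_neg_mul_rpow hp zero_lt_one hz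
  refine h.congr_fun (fun t _ => ?_) measurableSet_Ioi
  simp [mul_comm]

lemma one_add_rpow_le_one {q t : ℝ} (hq : q ≤ 0) (ht : 0 < t) : (1 + t) ^ q ≤ 1 :=
  Real.rpow_le_one_of_one_le_of_nonpos (by linarith) hq

lemma measurable_laplace_integrand (p q z : ℝ) :
    Measurable fun t : ℝ => Real.exp (-z * t) * t ^ p * (1 + t) ^ q := by
  fun_prop

lemma integrableOn_laplace {p q z : ℝ} (hp : -1 < p) (hq : q ≤ 0) (hz : 0 < z) :
    IntegrableOn (fun t : ℝ => Real.exp (-z * t) * t ^ p * (1 + t) ^ q) (Ioi 0) := by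
  refine (integrableOn_exp_mul_rpow hp hz).mono'
    (measurable_laplace_integrand p q z).aestronglyMeasurable ?_
  refine (ae_restrict_iff' measurableSet_Ioi).2 (ae_of_all _ fun t (ht : 0 < t) => ?_)
  have h1 : 0 < Real.exp (-z * t) * t ^ p := mul_pos (Real.exp_pos _) (Real.rpow_pos_of_pos ht _)
  have h2 : 0 < (1 + t) ^ q := Real.rpow_pos_of_pos (by linarith) _
  rw [Real.norm_of_nonneg (by positivity)]
  exact mul_le_of_le_one_right h1.le (one_add_rpow_le_one hq ht)

lemma laplaceInt_pos {p q z : ℝ} (hp : -1 < p) (hq : q ≤ 0) (hz : 0 < z) :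
    0 < laplaceInt p q z := by
  have hpos : ∀ t ∈ Ioi (0 : ℝ), 0 < Real.exp (-z * t) * t ^ p * (1 + t) ^ q := fun t ht =>
    mul_pos (mul_pos (Real.exp_pos _) (Real.rpow_pos_of_pos ht _))
      (Real.rpow_pos_of_pos (by linarith [mem_Ioi.1 ht]) _)
  unfold laplaceInt
  rw [setIntegral_pos_iff_support_of_nonneg_ae
    ((ae_restrict_iff' measurableSet_Ioi).2 (ae_of_all _ fun t ht => (hpos t ht).le))
    (integrableOn_laplace hp hq hz)]
  have : Ioi (0 : ℝ) ⊆ Function.support (fun t : ℝ => Real.exp (-z * t) * t ^ p * (1 + t) ^ q) :=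
    fun t ht => (hpos t ht).ne'
  rw [inter_eq_right.2 this]
  simp

/-- Differentiation under the integral sign: for w within z/2 of z the derivative of the integrand
is dominated by e^{-zt/2} t^{p+1}. -/
lemma hasDerivAt_laplaceInt {p q z : ℝ} (hp : -1 < p) (hq : q ≤ 0) (hz : 0 < z) :
    HasDerivAt (laplaceInt p q) (-laplaceInt (p + 1) q z) z := by
  have hball : Metric.ball z (z / 2) ∈ 𝓝 z := Metric.ball_mem_nhds z (by positivity)
  have key := hasDerivAt_integral_of_dominated_loc_of_deriv_le
    (μ := volume.restrict (Ioi (0 : ℝ))) (x₀ := z)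
    (F := fun w t => Real.exp (-w * t) * t ^ p * (1 + t) ^ q)
    (F' := fun w t => -(Real.exp (-w * t) * t ^ (p + 1) * (1 + t) ^ q))
    (bound := fun t => Real.exp (-(z / 2) * t) * t ^ (p + 1)) hball
    (Eventually.of_forall fun w => (measurable_laplace_integrand p q w).aestronglyMeasurable)
    (integrableOn_laplace hp hq hz)
    (measurable_laplace_integrand (p + 1) q z).neg.aestronglyMeasurable
    ((ae_restrict_iff' measurableSet_Ioi).2 (ae_of_all _ fun t ht w hw => ?_))
    (integrableOn_exp_mul_rpow (by linarith) (by positivity))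
    ((ae_restrict_iff' measurableSet_Ioi).2 (ae_of_all _ fun t ht w hw => ?_))
  · have h := key.2
    rw [integral_neg] at h
    exact h
  · have ht0 : 0 < t := ht
    have hw' : z / 2 ≤ w := by
      rw [Metric.mem_ball, Real.dist_eq] at hw
      linarith [(abs_lt.1 hw).1]
    have h2 : 0 < (1 + t) ^ q := Real.rpow_pos_of_pos (by linarith) _
    have h3 : 0 < t ^ (p + 1) := Real.rpow_pos_of_pos ht0 _
    rw [norm_neg, Real.norm_of_nonneg (by positivity)]
    refine (mul_le_of_le_one_right (by positivity) (one_add_rpow_le_one hq ht0)).trans ?_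
    refine mul_le_mul_of_nonneg_right (Real.exp_le_exp.2 ?_) h3.le
    nlinarith
  · have ht0 : 0 < t := ht
    have h : HasDerivAt (fun w : ℝ => Real.exp (-w * t)) (Real.exp (-w * t) * (-1 * t)) w :=
      ((hasDerivAt_neg w).mul_const t).exp
    refine ((h.mul_const (t ^ p)).mul_const ((1 + t) ^ q)).congr_deriv ?_
    rw [Real.rpow_add_one ht0.ne']
    ring

lemma tendsto_exp_mul_rpow_atTop (p : ℝ) {z : ℝ} (hz : 0 < z) :
    Tendsto (fun t : ℝ => Real.exp (-z * t) * t ^ p) atTop (𝓝 0) := by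
  simpa [mul_comm] using tendsto_rpow_mul_exp_neg_mul_atTop_nhds_zero p z hz

/-- Kummer's equation in integrated form. -/
lemma laplaceInt_kummer {a b z : ℝ} (ha : 0 < a) (hb : b - a - 1 ≤ 0) (hz : 0 < z) :
    z * laplaceInt (a + 1) (b - a - 1) z - (b - z) * laplaceInt a (b - a - 1) z -
      a * laplaceInt (a - 1) (b - a - 1) z = 0 := by
  set q : ℝ := b - a - 1 with hq
  have hi2 := integrableOn_laplace (p := a + 1) (by linarith) hb hz
  have hi1 := integrableOn_laplace (p := a) (by linarith) hb hz
  have hi0 := integrableOn_laplace (p := a - 1) (by linarith) hb hz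
  -- The combination in the statement is minus the integral of F', and F vanishes at 0 (as a > 0)
  -- and at infinity.
  set F : ℝ → ℝ := fun t => Real.exp (-z * t) * t ^ a * (1 + t) ^ (q + 1) with hF
  have hd : ∀ t ∈ Ioi (0 : ℝ), HasDerivAt F
      (-(z * (Real.exp (-z * t) * t ^ (a + 1) * (1 + t) ^ q) -
        (b - z) * (Real.exp (-z * t) * t ^ a * (1 + t) ^ q) -
        a * (Real.exp (-z * t) * t ^ (a - 1) * (1 + t) ^ q))) t := by
    intro t ht
    have ht0 : 0 < t := ht
    have h1 : HasDerivAt (fun w : ℝ => Real.exp (-z * w)) (Real.exp (-z * t) * (-z * 1)) t :=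
      ((hasDerivAt_id t).const_mul (-z)).exp
    have h2 : HasDerivAt (fun w : ℝ => w ^ a) (a * t ^ (a - 1)) t :=
      Real.hasDerivAt_rpow_const (Or.inl ht0.ne')
    have h3 : HasDerivAt (fun w : ℝ => (1 + w) ^ (q + 1)) (1 * (q + 1) * (1 + t) ^ (q + 1 - 1)) t :=
      ((hasDerivAt_id t).const_add 1).rpow_const (Or.inl (by simp; linarith))
    refine ((h1.mul h2).mul h3).congr_deriv ?_
    have e1 : t ^ a = t ^ (a - 1) * t := by
      rw [← Real.rpow_add_one ht0.ne', sub_add_cancel]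
    have e2 : t ^ (a + 1) = t ^ (a - 1) * t * t := by
      rw [Real.rpow_add_one ht0.ne', e1]
    have e3 : (1 + t) ^ (q + 1) = (1 + t) ^ q * (1 + t) :=
      Real.rpow_add_one (by linarith) _
    simp only [Pi.mul_apply]
    rw [add_sub_cancel_right, e2, e3, e1, show q = b - a - 1 from hq]
    ring
  have hint : IntegrableOn (fun t : ℝ =>
      -(z * (Real.exp (-z * t) * t ^ (a + 1) * (1 + t) ^ q) -
        (b - z) * (Real.exp (-z * t) * t ^ a * (1 + t) ^ q) -
        a * (Real.exp (-z * t) * t ^ (a - 1) * (1 + t) ^ q))) (Ioi 0) :=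
    (((hi2.const_mul z).sub (hi1.const_mul (b - z))).sub (hi0.const_mul a)).neg
  have hlim : Tendsto F atTop (𝓝 0) := by
    have h1 : Tendsto (fun t : ℝ => Real.exp (-z * t) * t ^ a + Real.exp (-z * t) * t ^ (a + 1))
        atTop (𝓝 0) := by
      simpa using (tendsto_exp_mul_rpow_atTop a hz).add (tendsto_exp_mul_rpow_atTop (a + 1) hz)
    refine squeeze_zero' ?_ ?_ h1
    · filter_upwards [eventually_gt_atTop 0] with t ht
      have h2 : 0 < (1 + t) ^ (q + 1) := Real.rpow_pos_of_pos (by linarith) _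
      positivity
    · filter_upwards [eventually_gt_atTop 0] with t ht
      have h2 : (1 + t) ^ (q + 1) ≤ 1 + t := by
        rw [Real.rpow_add_one (by linarith)]
        exact mul_le_of_le_one_left (by linarith) (one_add_rpow_le_one hb ht)
      have h3 : 0 ≤ Real.exp (-z * t) * t ^ a := by positivity
      rw [Real.rpow_add_one ht.ne']
      simp only [hF]
      nlinarith
  have hc : ContinuousWithinAt F (Ici 0) 0 := by
    have h2 : ContinuousAt (fun w : ℝ => w ^ a) 0 :=
      Real.continuousAt_rpow_const _ _ (Or.inr ha.le)
    have h3 : ContinuousAt (fun w : ℝ => (1 + w) ^ (q + 1)) 0 :=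
      ContinuousAt.rpow_const (by fun_prop) (Or.inl (by norm_num))
    have h1 : ContinuousAt (fun w : ℝ => Real.exp (-z * w)) 0 := by fun_prop
    exact ((h1.mul h2).mul h3).continuousWithinAt
  have key := integral_Ioi_of_hasDerivAt_of_tendsto hc hd hint hlim
  rw [integral_neg, integral_sub (by
    exact (hi2.const_mul z).sub (hi1.const_mul (b - z))) (hi0.const_mul a),
    integral_sub (hi2.const_mul z) (hi1.const_mul (b - z)), integral_const_mul,
    integral_const_mul, integral_const_mul] at key
  have hF0 : F 0 = 0 := by simp [hF, Real.zero_rpow ha.ne']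
  rw [hF0] at key
  unfold laplaceInt
  linarith

/-! ### The function V_s and the density κ_s for s > 1, s = 1 and s = 1/2. -/

/-- The properties of `V_s` and of its derivative on which the Stein solution depends. -/
structure IsKernel (s : ℝ) (W : ℝ → ℝ) : Prop where
  pos : ∀ x, 0 < x → 0 < V s x
  hasDerivAt : ∀ x, 0 < x → HasDerivAt (V s) (W x) x
  hasDerivAt' : ∀ x, 0 < x → HasDerivAt W ((x * W x + 2 * (s - 1) * V s x) / s) x
  integrable : IntegrableOn (density s) (Ioi 0)
  integral_eq_one : ∫ x in Ioi (0 : ℝ), density s x = 1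

lemma V_eq_laplaceInt {s : ℝ} (hs : 1 < s) (x : ℝ) :
    V s x = (Real.Gamma (s - 1))⁻¹ *
      laplaceInt (s - 1 - 1) (1 / 2 - (s - 1) - 1) (x ^ 2 / (2 * s)) := by
  rw [V, confluentU, if_pos (by linarith)]
  rfl

/-- The derivative of `V_s` for `s > 1`. -/
def derivV (s x : ℝ) : ℝ :=
  -((Real.Gamma (s - 1))⁻¹ * (x / s *
    laplaceInt (s - 1) (1 / 2 - (s - 1) - 1) (x ^ 2 / (2 * s))))

lemma hasDerivAt_sq_div (s x : ℝ) (hs : s ≠ 0) :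
    HasDerivAt (fun y : ℝ => y ^ 2 / (2 * s)) (x / s) x := by
  refine ((hasDerivAt_pow 2 x).div_const (2 * s)).congr_deriv ?_
  field_simp
  simp [mul_comm]

lemma hasDerivAt_V {s x : ℝ} (hs : 1 < s) (hx : 0 < x) : HasDerivAt (V s) (derivV s x) x := by
  have hs0 : 0 < s := by linarith
  have h := ((hasDerivAt_laplaceInt (p := s - 1 - 1) (q := 1 / 2 - (s - 1) - 1)
    (z := x ^ 2 / (2 * s)) (by linarith) (by linarith) (by positivity)).comp x
    (hasDerivAt_sq_div s x hs0.ne')).const_mul (Real.Gamma (s - 1))⁻¹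
  rw [sub_add_cancel] at h
  rw [show V s = fun y => (Real.Gamma (s - 1))⁻¹ * (laplaceInt (s - 1 - 1) (1 / 2 - (s - 1) - 1) ∘
    fun y => y ^ 2 / (2 * s)) y from funext fun y => V_eq_laplaceInt hs y]
  refine h.congr_deriv ?_
  rw [derivV]
  ring

/-- Kummer's equation at z = x²/(2s) becomes s V'' = x V' + 2(s-1) V. -/
lemma hasDerivAt_derivV {s x : ℝ} (hs : 1 < s) (hx : 0 < x) :
    HasDerivAt (derivV s) ((x * derivV s x + 2 * (s - 1) * V s x) / s) x := by
  have hs0 : 0 < s := by linarith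
  have h := ((((hasDerivAt_id x).div_const s).mul
    ((hasDerivAt_laplaceInt (p := s - 1) (q := 1 / 2 - (s - 1) - 1)
    (z := x ^ 2 / (2 * s)) (by linarith) (by linarith) (by positivity)).comp x
    (hasDerivAt_sq_div s x hs0.ne'))).const_mul (Real.Gamma (s - 1))⁻¹).neg
  have hk := laplaceInt_kummer (a := s - 1) (b := 1 / 2) (z := x ^ 2 / (2 * s))
    (by linarith) (by linarith) (by positivity)
  refine HasDerivAt.congr_deriv (f' := _) h ?_
  rw [V_eq_laplaceInt hs, derivV]
  simp only [id, Function.comp]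
  set J2 := laplaceInt (s - 1 + 1) (1 / 2 - (s - 1) - 1) (x ^ 2 / (2 * s))
  set J1 := laplaceInt (s - 1) (1 / 2 - (s - 1) - 1) (x ^ 2 / (2 * s))
  set J0 := laplaceInt (s - 1 - 1) (1 / 2 - (s - 1) - 1) (x ^ 2 / (2 * s))
  set G := (Real.Gamma (s - 1))⁻¹
  have hk' : x ^ 2 * J2 = s * J1 - x ^ 2 * J1 + 2 * s * (s - 1) * J0 := by
    field_simp at hk
    linarith
  field_simp
  linear_combination G * hk'

lemma V_pos {s x : ℝ} (hs : 1 < s) (hx : 0 < x) : 0 < V s x := by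
  rw [V_eq_laplaceInt hs]
  exact mul_pos (inv_pos.2 (Real.Gamma_pos_of_pos (by linarith)))
    (laplaceInt_pos (by linarith) (by linarith) (by positivity))

lemma derivV_nonpos {s x : ℝ} (hs : 1 < s) (hx : 0 < x) : derivV s x ≤ 0 := by
  have h1 := inv_pos.2 (Real.Gamma_pos_of_pos (s := s - 1) (by linarith))
  have h2 : 0 < laplaceInt (s - 1) (1 / 2 - (s - 1) - 1) (x ^ 2 / (2 * s)) :=
    laplaceInt_pos (by linarith) (by linarith) (by positivity)
  have hs0 : 0 < s := by linarith
  rw [derivV, neg_nonpos]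
  positivity

lemma integral_exp_mul_rpow {p z : ℝ} (hp : 0 < p) (hz : 0 < z) :
    ∫ t in Ioi (0 : ℝ), Real.exp (-z * t) * t ^ (p - 1) = (1 / z) ^ p * Real.Gamma p := by
  rw [← Real.integral_rpow_mul_exp_neg_mul_Ioi hp hz]
  refine setIntegral_congr_fun measurableSet_Ioi fun t _ => ?_
  simp [mul_comm]

/-- The exponent of 1+t is negative, so 1+t may be replaced by t, and the powers combine to
t^{-1/2}. The resulting Gamma integral is a multiple of 1/x, which the prefactor x/s cancels. -/
lemma abs_derivV_le {s : ℝ} (hs : 1 < s) : ∃ K, ∀ x, 0 < x → |derivV s x| ≤ K := by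
  have hs0 : 0 < s := by linarith
  have hG := inv_pos.2 (Real.Gamma_pos_of_pos (s := s - 1) (by linarith))
  refine ⟨(Real.Gamma (s - 1))⁻¹ * (1 / s * (√(2 * s) * Real.Gamma (1 / 2))), fun x hx => ?_⟩
  have hz : 0 < x ^ 2 / (2 * s) := by positivity
  have h1 : laplaceInt (s - 1) (1 / 2 - (s - 1) - 1) (x ^ 2 / (2 * s)) ≤
      (1 / (x ^ 2 / (2 * s))) ^ (1 / 2 : ℝ) * Real.Gamma (1 / 2) := by
    rw [← integral_exp_mul_rpow (by norm_num) hz, laplaceInt]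
    refine setIntegral_mono_on (integrableOn_laplace (by linarith) (by linarith) hz)
      (integrableOn_exp_mul_rpow (by norm_num) hz) measurableSet_Ioi fun t ht => ?_
    have ht0 : 0 < t := ht
    rw [mul_assoc]
    refine mul_le_mul_of_nonneg_left ?_ (Real.exp_pos _).le
    calc t ^ (s - 1) * (1 + t) ^ (1 / 2 - (s - 1) - 1)
        ≤ t ^ (s - 1) * t ^ (1 / 2 - (s - 1) - 1) := by
          refine mul_le_mul_of_nonneg_left ?_ (by positivity)
          exact Real.rpow_le_rpow_of_nonpos ht0 (by linarith) (by linarith)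
      _ = t ^ (1 / 2 - 1 : ℝ) := by
          rw [← Real.rpow_add ht0]
          congr 1
          ring
  have h2 : (1 / (x ^ 2 / (2 * s))) ^ (1 / 2 : ℝ) = √(2 * s) / x := by
    rw [← Real.sqrt_eq_rpow, one_div_div, Real.sqrt_div (by positivity), Real.sqrt_sq hx.le]
  rw [h2] at h1
  have h3 : 0 < laplaceInt (s - 1) (1 / 2 - (s - 1) - 1) (x ^ 2 / (2 * s)) :=
    laplaceInt_pos (by linarith) (by linarith) hz
  rw [derivV, abs_neg, abs_of_nonneg (by positivity)]
  refine mul_le_mul_of_nonneg_left ?_ hG.le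
  calc _ ≤ x / s * (√(2 * s) / x * Real.Gamma (1 / 2)) := by gcongr
    _ = _ := by field_simp

/-- An antiderivative is (t/(1+t))^{s-1}/(s-1), rising from 0 to 1/(s-1). -/
lemma integral_beta_type {s : ℝ} (hs : 1 < s) :
    IntegrableOn (fun t : ℝ => t ^ (s - 1 - 1) * (1 + t) ^ (-s)) (Ioi 0) ∧
    ∫ t in Ioi (0 : ℝ), t ^ (s - 1 - 1) * (1 + t) ^ (-s) = 1 / (s - 1) := by
  have hs1 : 0 < s - 1 := by linarith
  have hd : ∀ t ∈ Ioi (0 : ℝ), HasDerivAt (fun t : ℝ => (t / (1 + t)) ^ (s - 1) / (s - 1))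
      (t ^ (s - 1 - 1) * (1 + t) ^ (-s)) t := by
    intro t ht
    have ht0 : 0 < t := ht
    have h1 : (1 + t) ≠ 0 := by positivity
    have h := ((((hasDerivAt_id t).fun_div ((hasDerivAt_id t).const_add 1) h1).rpow_const
      (p := s - 1) (Or.inl (by simp only [id]; positivity))).div_const (s - 1))
    refine h.congr_deriv ?_
    simp only [id]
    have e1 : (1 + t) ^ (-s) = (1 + t) ^ (-(s - 1 - 1)) * ((1 + t) ^ 2)⁻¹ := by
      rw [← Real.rpow_natCast, ← Real.rpow_neg (by positivity), ← Real.rpow_add (by positivity)]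
      congr 1
      push_cast
      ring
    rw [Real.div_rpow ht0.le (by positivity), e1, Real.rpow_neg (by positivity)]
    field_simp
    ring
  have hp : ∀ t ∈ Ioi (0 : ℝ), 0 ≤ t ^ (s - 1 - 1) * (1 + t) ^ (-s) := fun t ht =>
    mul_nonneg (Real.rpow_nonneg (le_of_lt ht) _)
      (Real.rpow_nonneg (by linarith [mem_Ioi.1 ht]) _)
  have hc : ContinuousWithinAt (fun t : ℝ => (t / (1 + t)) ^ (s - 1) / (s - 1)) (Ici 0) 0 := by
    refine ContinuousAt.continuousWithinAt (ContinuousAt.div_const ?_ _)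
    refine ContinuousAt.rpow_const (ContinuousAt.div (by fun_prop) (by fun_prop) (by norm_num))
      (Or.inr hs1.le)
  have hl : Tendsto (fun t : ℝ => (t / (1 + t)) ^ (s - 1) / (s - 1)) atTop
      (𝓝 (1 / (s - 1))) := by
    refine Tendsto.div_const ?_ _
    have h1 : Tendsto (fun t : ℝ => t / (1 + t)) atTop (𝓝 1) := by
      have h2 : Tendsto (fun t : ℝ => 1 - (1 + t)⁻¹) atTop (𝓝 (1 - 0)) :=
        tendsto_const_nhds.sub (tendsto_inv_atTop_zero.comp
          (tendsto_atTop_add_const_left _ 1 tendsto_id))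
      rw [sub_zero] at h2
      refine h2.congr' ?_
      filter_upwards [eventually_gt_atTop 0] with t ht
      field_simp
      ring
    simpa using h1.rpow_const (p := s - 1) (Or.inl one_ne_zero)
  refine ⟨integrableOn_Ioi_deriv_of_nonneg hc hd hp hl, ?_⟩
  rw [integral_Ioi_of_hasDerivAt_of_nonneg hc hd hp hl]
  simp [Real.zero_rpow hs1.ne']

/-- Insert the integral representation of U and exchange the integrals. The x-integral is Gaussian
with rate (1+t)/(2s) and leaves the beta-type integral 1/(s-1), which cancels against Γ(s) = (s-1)
Γ(s-1). -/
lemma integral_density {s : ℝ} (hs : 1 < s) :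
    IntegrableOn (density s) (Ioi 0) ∧ ∫ x in Ioi (0 : ℝ), density s x = 1 := by
  have hs0 : 0 < s := by linarith
  set μ : Measure ℝ := volume.restrict (Ioi (0 : ℝ)) with hμ
  set F : ℝ → ℝ → ℝ := fun x t =>
    Real.exp (-((1 + t) / (2 * s)) * x ^ 2) * (t ^ (s - 1 - 1) * (1 + t) ^ (1 / 2 - s)) with hF
  set C : ℝ := √(2 * Real.pi * s) / 2 with hC
  have hinner : ∀ t : ℝ, 0 < t →
      ∫ x, F x t ∂μ = C * (t ^ (s - 1 - 1) * (1 + t) ^ (-s)) := by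
    intro t ht
    simp only [hF]
    rw [integral_mul_const, hμ, integral_gaussian_Ioi]
    have e1 : √(Real.pi / ((1 + t) / (2 * s))) = √(2 * Real.pi * s) * (1 + t) ^ (-(1 / 2) : ℝ) := by
      rw [div_div_eq_mul_div, Real.sqrt_div (by positivity), Real.rpow_neg (by positivity),
        ← Real.sqrt_eq_rpow, div_eq_mul_inv]
      congr 2
      ring
    have e2 : (1 + t) ^ (-s) = (1 + t) ^ (-(1 / 2) : ℝ) * (1 + t) ^ (1 / 2 - s) := by
      rw [← Real.rpow_add (by positivity)]
      congr 1
      ring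
    rw [e1, e2, hC]
    ring
  have hnonneg : ∀ x t : ℝ, 0 < t → 0 ≤ F x t := fun x t ht => by
    have : 0 < 1 + t := by linarith
    simp only [hF]
    positivity
  have hmeas : Measurable (Function.uncurry F) := by
    simp only [hF, Function.uncurry_def]
    fun_prop
  have hb := integral_beta_type hs
  have hint : Integrable (Function.uncurry F) (μ.prod μ) := by
    rw [integrable_prod_iff' hmeas.aestronglyMeasurable]
    constructor
    · refine (ae_restrict_iff' measurableSet_Ioi).2 (ae_of_all _ fun t (ht : 0 < t) => ?_)
      exact ((integrable_exp_neg_mul_sq (b := (1 + t) / (2 * s))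
        (by positivity)).integrableOn (s := Ioi 0)).mul_const (t ^ (s - 1 - 1) * (1 + t) ^ (1 / 2 - s))
    · refine IntegrableOn.congr_fun (hb.1.const_mul C) (fun t ht => ?_) measurableSet_Ioi
      rw [← hinner t ht]
      refine integral_congr_ae (ae_of_all _ fun x => ?_)
      exact (Real.norm_of_nonneg (hnonneg x t ht)).symm
  have hdens : ∀ x : ℝ, density s x =
      Real.Gamma s * √(2 / (s * Real.pi)) * (Real.Gamma (s - 1))⁻¹ * ∫ t, F x t ∂μ := by
    intro x
    rw [density, V_eq_laplaceInt hs, laplaceInt]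
    have : ∫ t, F x t ∂μ = Real.exp (-x ^ 2 / (2 * s)) * ∫ t in Ioi (0 : ℝ),
        Real.exp (-(x ^ 2 / (2 * s)) * t) * t ^ (s - 1 - 1) *
          (1 + t) ^ (1 / 2 - (s - 1) - 1) := by
      rw [← integral_const_mul]
      refine integral_congr_ae (ae_of_all _ fun t => ?_)
      simp only [hF]
      rw [show (1 / 2 - (s - 1) - 1 : ℝ) = 1 / 2 - s by ring, ← mul_assoc, ← mul_assoc,
        ← mul_assoc, ← Real.exp_add]
      congr 3
      field_simp
      ring
    rw [this]
    ring
  have hfun : density s = fun x => Real.Gamma s * √(2 / (s * Real.pi)) *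
      (Real.Gamma (s - 1))⁻¹ * ∫ t, F x t ∂μ := funext hdens
  constructor
  · rw [hfun]
    exact hint.integral_prod_left.const_mul _
  · rw [hfun, integral_const_mul, integral_integral_swap hint]
    have : ∫ t, ∫ x, F x t ∂μ ∂μ = ∫ t in Ioi (0 : ℝ), C * (t ^ (s - 1 - 1) * (1 + t) ^ (-s)) :=
      setIntegral_congr_fun measurableSet_Ioi fun t ht => hinner t ht
    rw [this, integral_const_mul, hb.2, hC]
    have hG : Real.Gamma s = (s - 1) * Real.Gamma (s - 1) := by
      have := Real.Gamma_add_one (s := s - 1) (by linarith)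
      rwa [sub_add_cancel] at this
    have hG0 : Real.Gamma (s - 1) ≠ 0 := (Real.Gamma_pos_of_pos (by linarith)).ne'
    have hsq : √(2 / (s * Real.pi)) * √(2 * Real.pi * s) = 2 := by
      rw [← Real.sqrt_mul (by positivity),
        show 2 / (s * Real.pi) * (2 * Real.pi * s) = 2 ^ 2 by
          have := Real.pi_pos
          field_simp]
      exact Real.sqrt_sq (by norm_num)
    rw [hG]
    have hs1 : s - 1 ≠ 0 := by linarith
    calc _ = √(2 / (s * Real.pi)) * √(2 * Real.pi * s) / 2 *
          ((s - 1) * (1 / (s - 1)) * (Real.Gamma (s - 1) * (Real.Gamma (s - 1))⁻¹)) := by ring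
      _ = 1 := by rw [hsq, mul_one_div_cancel hs1, mul_inv_cancel₀ hG0]; norm_num

lemma isKernel_of_one_lt {s : ℝ} (hs : 1 < s) : IsKernel s (derivV s) where
  pos _ hx := V_pos hs hx
  hasDerivAt _ hx := hasDerivAt_V hs hx
  hasDerivAt' _ hx := hasDerivAt_derivV hs hx
  integrable := (integral_density hs).1
  integral_eq_one := (integral_density hs).2

/-- Here a = 0 lies outside the integral representation. One application of the contiguous relation
gives two integrals whose sum is that of the total derivative of -e^{-zt}(1+t)^{-1/2}, so it equals
1. -/
lemma V_one {x : ℝ} (hx : 0 < x) : V 1 x = 1 := by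
  have hz : 0 < x ^ 2 / (2 * 1) := by positivity
  rw [V, confluentU, if_neg (by norm_num)]
  set z := x ^ 2 / (2 * 1)
  norm_num [confluentUAux, confluentUIntegral]
  have hi1 := integrableOn_laplace (p := 0) (q := -(1 / 2)) (by norm_num) (by norm_num) hz
  have hi2 := integrableOn_laplace (p := 0) (q := -(3 / 2)) (by norm_num) (by norm_num) hz
  simp only [Real.rpow_zero, mul_one, neg_mul] at hi1 hi2
  have hd : ∀ t ∈ Ioi (0 : ℝ), HasDerivAt
      (fun t : ℝ => -(Real.exp (-(z * t)) * (1 + t) ^ (-(1 / 2) : ℝ)))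
      (z * (Real.exp (-(z * t)) * (1 + t) ^ (-(1 / 2) : ℝ)) +
        1 / 2 * (Real.exp (-(z * t)) * (1 + t) ^ (-(3 / 2) : ℝ))) t := by
    intro t ht
    have ht0 : 0 < t := ht
    have h1 : HasDerivAt (fun w : ℝ => Real.exp (-(z * w))) (Real.exp (-(z * t)) * (-(z * 1))) t :=
      (((hasDerivAt_id t).const_mul z).fun_neg).exp
    have h3 : HasDerivAt (fun w : ℝ => (1 + w) ^ (-(1 / 2) : ℝ))
        (1 * (-(1 / 2)) * (1 + t) ^ (-(1 / 2) - 1 : ℝ)) t :=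
      ((hasDerivAt_id t).const_add 1).rpow_const (Or.inl (by simp; linarith))
    refine (h1.fun_mul h3).fun_neg.congr_deriv ?_
    rw [show (-(1 / 2) - 1 : ℝ) = -(3 / 2) by norm_num]
    ring
  have hc : ContinuousWithinAt
      (fun t : ℝ => -(Real.exp (-(z * t)) * (1 + t) ^ (-(1 / 2) : ℝ))) (Ici 0) 0 := by
    have h3 : ContinuousAt (fun w : ℝ => (1 + w) ^ (-(1 / 2) : ℝ)) 0 :=
      ContinuousAt.rpow_const (by fun_prop) (Or.inl (by norm_num))
    have h1 : ContinuousAt (fun w : ℝ => Real.exp (-(z * w))) 0 := by fun_prop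
    exact (h1.mul h3).neg.continuousWithinAt
  have hl : Tendsto (fun t : ℝ => -(Real.exp (-(z * t)) * (1 + t) ^ (-(1 / 2) : ℝ)))
      atTop (𝓝 0) := by
    rw [← neg_zero]
    refine Tendsto.neg ?_
    have h1 := tendsto_exp_mul_rpow_atTop 0 hz
    simp only [Real.rpow_zero, mul_one, neg_mul] at h1
    refine squeeze_zero' ?_ ?_ h1
    · filter_upwards [eventually_gt_atTop 0] with t ht
      positivity
    · filter_upwards [eventually_gt_atTop 0] with t ht
      exact mul_le_of_le_one_right (Real.exp_pos _).le (one_add_rpow_le_one (by norm_num) ht)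
  have key := integral_Ioi_of_hasDerivAt_of_tendsto hc hd
    ((hi1.const_mul z).add (hi2.const_mul (1 / 2))) hl
  rw [integral_add (hi1.const_mul z) (hi2.const_mul (1 / 2)), integral_const_mul,
    integral_const_mul] at key
  norm_num at key
  convert key using 1

lemma density_one {x : ℝ} (hx : 0 < x) :
    density 1 x = √(2 / Real.pi) * Real.exp (-x ^ 2 / (2 * 1)) := by
  rw [density, V_one hx]
  simp

lemma isKernel_one : IsKernel 1 fun _ => 0 where
  pos x hx := by rw [V_one hx]; exact one_pos
  hasDerivAt x hx := (hasDerivAt_const x (1 : ℝ)).congr_of_eventuallyEq (by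
    filter_upwards [Ioi_mem_nhds hx] with y hy using V_one hy)
  hasDerivAt' x _ := (hasDerivAt_const x (0 : ℝ)).congr_deriv (by simp)
  integrable := IntegrableOn.congr_fun
    ((integrableOn_gauss one_pos 0).const_mul (√(2 / Real.pi)))
    (fun x hx => (density_one hx).symm) measurableSet_Ioi
  integral_eq_one := by
    rw [setIntegral_congr_fun measurableSet_Ioi fun x hx => density_one hx, integral_const_mul,
      integral_gauss_Ioi_zero one_pos, mul_div_assoc', ← Real.sqrt_mul (by positivity),
      show 2 / Real.pi * (2 * Real.pi * 1) = 2 ^ 2 by field_simp,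
      Real.sqrt_sq (by norm_num)]
    norm_num

/-- For a = -1/2 and b = 1/2 the factor a+1-b in the contiguous relation is 0, and in the other term
the power of 1+t is 0. What is left is z · z^{-1/2} with z = x². -/
lemma V_half {x : ℝ} (hx : 0 < x) : V (1 / 2) x = x := by
  have hz : 0 < x ^ 2 := by positivity
  rw [V, confluentU, if_neg (by norm_num)]
  have h1 := integral_exp_mul_rpow (p := 1 / 2) (by norm_num) hz
  have hfl : ⌊-(1 / 2 - 1 : ℝ)⌋₊ = 0 := by norm_num
  have hG : Real.Gamma (1 / 2) ≠ 0 := (Real.Gamma_pos_of_pos (by norm_num)).ne'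
  rw [hfl, show x ^ 2 / (2 * (1 / 2)) = x ^ 2 by ring]
  simp only [confluentUAux, confluentUIntegral]
  rw [show (1 / 2 - 1 + 1 : ℝ) = 1 / 2 by norm_num,
    show (1 / 2 + 1 - 1 / 2 - 1 : ℝ) = 0 by norm_num]
  simp only [Real.rpow_zero, mul_one]
  rw [h1, ← Real.sqrt_eq_rpow, Real.sqrt_div zero_le_one, Real.sqrt_sq hx.le, Real.sqrt_one]
  field_simp
  ring

lemma density_half {x : ℝ} (hx : 0 < x) :
    density (1 / 2) x = 2 * (x * Real.exp (-x ^ 2 / (2 * (1 / 2)))) := by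
  rw [density, V_half hx, Real.Gamma_one_half_eq, ← Real.sqrt_mul Real.pi_pos.le,
    show Real.pi * (2 / (1 / 2 * Real.pi)) = 2 ^ 2 by field_simp,
    Real.sqrt_sq (by norm_num)]
  ring

lemma isKernel_half : IsKernel (1 / 2) fun _ => 1 where
  pos x hx := by rw [V_half hx]; exact hx
  hasDerivAt x hx := (hasDerivAt_id x).congr_of_eventuallyEq (by
    filter_upwards [Ioi_mem_nhds hx] with y hy using V_half hy)
  hasDerivAt' x hx := (hasDerivAt_const x (1 : ℝ)).congr_deriv (by rw [V_half hx]; norm_num)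
  integrable := IntegrableOn.congr_fun
    ((integral_mul_gauss_Ioi (s := 1 / 2) (by norm_num) le_rfl).1.const_mul 2)
    (fun x hx => (density_half hx).symm) measurableSet_Ioi
  integral_eq_one := by
    rw [setIntegral_congr_fun measurableSet_Ioi fun x hx => density_half hx, integral_const_mul,
      (integral_mul_gauss_Ioi (by norm_num) le_rfl).2]
    norm_num

lemma exists_isKernel_of_one_le {s : ℝ} (hs : 1 ≤ s) : ∃ W : ℝ → ℝ, IsKernel s W ∧
    (∀ x, 0 < x → W x ≤ 0) ∧ ∃ K, ∀ x, 0 < x → |W x| ≤ K := by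
  rcases hs.eq_or_lt with rfl | hs
  · exact ⟨_, isKernel_one, fun _ _ => le_rfl, 0, fun _ _ => by simp⟩
  · exact ⟨_, isKernel_of_one_lt hs, fun _ hx => derivV_nonpos hs hx, abs_derivV_le hs⟩

/-! ### The Stein solution as variation of constants. -/

/-- The inner integral in the definition of the Stein solution. -/
def innerInt (s : ℝ) (h : ℝ → ℝ) (y : ℝ) : ℝ :=
  ∫ t in (0 : ℝ)..y, (h t - mean s h) * density s t

/-- The outer integral in the definition of the Stein solution. -/
def outerInt (s : ℝ) (h : ℝ → ℝ) (x : ℝ) : ℝ :=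
  ∫ y in (0 : ℝ)..x, 1 / (V s y * density s y) * innerInt s h y

/-- The first derivative of the Stein solution, in terms of the derivative `W` of `V s`. -/
def derivSol (s : ℝ) (W h : ℝ → ℝ) (x : ℝ) : ℝ :=
  1 / s * (W x * outerInt s h x + innerInt s h x / density s x)

/-- The normalizing constant of the density. -/
def normConst (s : ℝ) : ℝ := Real.Gamma s * √(2 / (s * Real.pi))

lemma normConst_pos {s : ℝ} (hs : 0 < s) : 0 < normConst s :=
  mul_pos (Real.Gamma_pos_of_pos hs) (Real.sqrt_pos.2 (by positivity))

lemma density_eq (s x : ℝ) : density s x = normConst s * Real.exp (-x ^ 2 / (2 * s)) * V s x := rfl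

section Kernel

variable {s : ℝ} {W : ℝ → ℝ}

lemma IsKernel.density_pos (hk : IsKernel s W) (hs : 0 < s) {x : ℝ} (hx : 0 < x) :
    0 < density s x :=
  mul_pos (mul_pos (normConst_pos hs) (Real.exp_pos _)) (hk.pos x hx)

lemma IsKernel.hasDerivAt_density (hk : IsKernel s W) {x : ℝ} (hx : 0 < x) :
    HasDerivAt (density s)
      (normConst s * Real.exp (-x ^ 2 / (2 * s)) * (W x - x / s * V s x)) x := by
  refine ((((hasDerivAt_gauss s x).const_mul (normConst s)).fun_mul
    (hk.hasDerivAt x hx)).congr_deriv ?_)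
  ring

lemma IsKernel.continuousOn_V (hk : IsKernel s W) : ContinuousOn (V s) (Ioi 0) :=
  fun x hx => (hk.hasDerivAt x hx).continuousAt.continuousWithinAt

lemma IsKernel.continuousOn_deriv (hk : IsKernel s W) : ContinuousOn W (Ioi 0) :=
  fun x hx => (hk.hasDerivAt' x hx).continuousAt.continuousWithinAt

lemma IsKernel.continuousOn_density (hk : IsKernel s W) : ContinuousOn (density s) (Ioi 0) :=
  fun _ hx => (hk.hasDerivAt_density hx).continuousAt.continuousWithinAt

variable {h : ℝ → ℝ} {M : ℝ}

lemma IsKernel.integrable_mul_density (hk : IsKernel s W)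
    (hm : AEMeasurable h (volume.restrict (Ioi 0))) (hM : ∀ x, 0 < x → |h x| ≤ M) :
    IntegrableOn (fun x => h x * density s x) (Ioi 0) :=
  Integrable.bdd_mul (c := M) hk.integrable hm.aestronglyMeasurable
    ((ae_restrict_iff' measurableSet_Ioi).2 (ae_of_all _ fun x hx => hM x hx))

lemma IsKernel.abs_mean_le (hk : IsKernel s W) (hs : 0 < s)
    (hM : ∀ x, 0 < x → |h x| ≤ M) : |mean s h| ≤ M := by
  have h1 : ‖mean s h‖ ≤ ∫ x in Ioi (0 : ℝ), M * density s x := by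
    refine norm_integral_le_of_norm_le (hk.integrable.const_mul M) ?_
    refine (ae_restrict_iff' measurableSet_Ioi).2 (ae_of_all _ fun x hx => ?_)
    rw [norm_mul, Real.norm_of_nonneg (hk.density_pos hs hx).le]
    exact mul_le_mul_of_nonneg_right (hM x hx) (hk.density_pos hs hx).le
  rwa [integral_const_mul, hk.integral_eq_one, mul_one] at h1

lemma IsKernel.abs_sub_mean_le (hk : IsKernel s W) (hs : 0 < s)
    (hM : ∀ x, 0 < x → |h x| ≤ M) {x : ℝ} (hx : 0 < x) : |h x - mean s h| ≤ 2 * M := by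
  have h1 := abs_le.1 (hk.abs_mean_le hs hM)
  have h2 := abs_le.1 (hM x hx)
  exact abs_le.2 ⟨by linarith, by linarith⟩

lemma IsKernel.integrable_sub_mean (hk : IsKernel s W) (hs : 0 < s)
    (hm : AEMeasurable h (volume.restrict (Ioi 0))) (hM : ∀ x, 0 < x → |h x| ≤ M) :
    IntegrableOn (fun x => (h x - mean s h) * density s x) (Ioi 0) :=
  hk.integrable_mul_density (hm.sub_const _) fun _ hx => hk.abs_sub_mean_le hs hM hx

lemma IsKernel.integral_sub_mean (hk : IsKernel s W)
    (hm : AEMeasurable h (volume.restrict (Ioi 0))) (hM : ∀ x, 0 < x → |h x| ≤ M) :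
    ∫ x in Ioi (0 : ℝ), (h x - mean s h) * density s x = 0 := by
  simp_rw [sub_mul]
  rw [integral_sub (hk.integrable_mul_density hm hM) (hk.integrable.const_mul _),
    integral_const_mul, hk.integral_eq_one, mul_one]
  exact sub_self _

/-- Nothing is known about the integrand on the negative axis. Cutting it off there makes it
integrable on all of ℝ, so the primitive is continuous, absolutely continuous and a.e.
differentiable. -/
lemma innerInt_eq {y : ℝ} (hy : 0 ≤ y) : innerInt s h y =
    ∫ t in (0 : ℝ)..y, (Ioi (0 : ℝ)).indicator (fun t => (h t - mean s h) * density s t) t := by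
  unfold innerInt
  rw [intervalIntegral.integral_of_le hy, intervalIntegral.integral_of_le hy]
  refine setIntegral_congr_fun measurableSet_Ioc fun t ht => ?_
  simp only [indicator_of_mem (mem_Ioi.2 ht.1)]

lemma IsKernel.integrable_indicator (hk : IsKernel s W) (hs : 0 < s)
    (hm : AEMeasurable h (volume.restrict (Ioi 0))) (hM : ∀ x, 0 < x → |h x| ≤ M) :
    Integrable ((Ioi (0 : ℝ)).indicator fun t => (h t - mean s h) * density s t) :=
  (hk.integrable_sub_mean hs hm hM).integrable_indicator measurableSet_Ioi

lemma IsKernel.locAC_innerInt (hk : IsKernel s W) (hs : 0 < s)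
    (hm : AEMeasurable h (volume.restrict (Ioi 0))) (hM : ∀ x, 0 < x → |h x| ≤ M) :
    LocAC (innerInt s h) := by
  refine LocAC.congr (fun a ha b hb => ?_) fun y hy => (innerInt_eq hy.le).symm
  have hi : IntervalIntegrable ((Ioi (0 : ℝ)).indicator fun t => (h t - mean s h) * density s t)
    volume 0 (max a b) := (hk.integrable_indicator hs hm hM).intervalIntegrable
  have := hi.absolutelyContinuousOnInterval_intervalIntegral (c := 0) left_mem_uIcc
  have ha0 : 0 < a := ha
  have hb0 : 0 < b := hb
  refine this.mono ?_
  rw [uIcc_of_le (a := 0) (le_max_of_le_left ha0.le)]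
  exact fun x hx => ⟨(uIcc_subset_Ioi_zero ha0 hb0 hx).le, hx.2⟩

lemma IsKernel.ae_hasDerivAt_innerInt (hk : IsKernel s W) (hs : 0 < s)
    (hm : AEMeasurable h (volume.restrict (Ioi 0))) (hM : ∀ x, 0 < x → |h x| ≤ M) :
    ∀ᵐ x, 0 < x → HasDerivAt (innerInt s h) ((h x - mean s h) * density s x) x := by
  filter_upwards [LocallyIntegrable.ae_hasDerivAt_integral
    (hk.integrable_indicator hs hm hM).locallyIntegrable] with x hx hx0
  have h1 := hx 0
  rw [indicator_of_mem (mem_Ioi.2 hx0)] at h1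
  refine h1.congr_of_eventuallyEq ?_
  filter_upwards [Ioi_mem_nhds hx0] with y hy using innerInt_eq (le_of_lt hy)

lemma IsKernel.abs_innerInt_le (hk : IsKernel s W) (hs : 0 < s)
    (hM : ∀ x, 0 < x → |h x| ≤ M) {y : ℝ} (hy : 0 < y) :
    |innerInt s h y| ≤ 2 * M * ∫ t in Ioc 0 y, density s t := by
  rw [innerInt, intervalIntegral.integral_of_le hy.le, ← integral_const_mul,
    ← Real.norm_eq_abs]
  refine norm_integral_le_of_norm_le
    ((hk.integrable.mono_set Ioc_subset_Ioi_self).const_mul _) ?_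
  refine (ae_restrict_iff' measurableSet_Ioc).2 (ae_of_all _ fun x hx => ?_)
  rw [norm_mul, Real.norm_of_nonneg (hk.density_pos hs hx.1).le]
  exact mul_le_mul_of_nonneg_right (hk.abs_sub_mean_le hs hM hx.1) (hk.density_pos hs hx.1).le

/-- The centred function has κ_s-integral 0, so the integral over (0,y] is minus the integral over
the tail. Only this form decays at infinity. -/
lemma IsKernel.abs_innerInt_le_tail (hk : IsKernel s W) (hs : 0 < s)
    (hm : AEMeasurable h (volume.restrict (Ioi 0)))
    (hM : ∀ x, 0 < x → |h x| ≤ M) {y : ℝ} (hy : 0 < y) :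
    |innerInt s h y| ≤ 2 * M * ∫ t in Ioi y, density s t := by
  have hi := hk.integrable_sub_mean hs hm hM
  have h1 : innerInt s h y = -∫ t in Ioi y, (h t - mean s h) * density s t := by
    rw [innerInt, intervalIntegral.integral_of_le hy.le, eq_neg_iff_add_eq_zero,
      ← setIntegral_union (by
        rw [Set.disjoint_left]
        exact fun t ht ht' => absurd ht.2 (not_le.2 ht')) measurableSet_Ioi
        (hi.mono_set Ioc_subset_Ioi_self) (hi.mono_set (Ioi_subset_Ioi hy.le)),
      Ioc_union_Ioi_eq_Ioi hy.le, hk.integral_sub_mean hm hM]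
  rw [h1, abs_neg, ← integral_const_mul, ← Real.norm_eq_abs]
  refine norm_integral_le_of_norm_le
    ((hk.integrable.mono_set (Ioi_subset_Ioi hy.le)).const_mul _) ?_
  refine (ae_restrict_iff' measurableSet_Ioi).2 (ae_of_all _ fun x hx => ?_)
  have hx0 : 0 < x := hy.trans hx
  rw [norm_mul, Real.norm_of_nonneg (hk.density_pos hs hx0).le]
  exact mul_le_mul_of_nonneg_right (hk.abs_sub_mean_le hs hM hx0) (hk.density_pos hs hx0).le

lemma IsKernel.continuousOn_outer_integrand (hk : IsKernel s W) (hs : 0 < s)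
    (hm : AEMeasurable h (volume.restrict (Ioi 0))) (hM : ∀ x, 0 < x → |h x| ≤ M) :
    ContinuousOn (fun y => 1 / (V s y * density s y) * innerInt s h y) (Ioi 0) :=
  (continuousOn_const.div (hk.continuousOn_V.mul hk.continuousOn_density) fun y hy =>
    (mul_pos (hk.pos y hy) (hk.density_pos hs hy)).ne').mul (hk.locAC_innerInt hs hm hM).continuousOn

lemma IsKernel.intervalIntegrable_outer (hk : IsKernel s W) (hs : 0 < s)
    (hm : AEMeasurable h (volume.restrict (Ioi 0))) (hM : ∀ x, 0 < x → |h x| ≤ M) {x B : ℝ}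
    (hx : 0 < x) (hB : ∀ y ∈ Ioc 0 x, |1 / (V s y * density s y) * innerInt s h y| ≤ B) :
    IntervalIntegrable (fun y => 1 / (V s y * density s y) * innerInt s h y) volume 0 x ∧
      |outerInt s h x| ≤ B * x := by
  constructor
  · rw [intervalIntegrable_iff_integrableOn_Ioc_of_le hx.le]
    refine IntegrableOn.of_bound (by simp) (((hk.continuousOn_outer_integrand hs hm hM).mono
      Ioc_subset_Ioi_self).aestronglyMeasurable measurableSet_Ioc) B
      ((ae_restrict_iff' measurableSet_Ioc).2 (ae_of_all _ hB))
  · have := intervalIntegral.norm_integral_le_of_norm_le_const (a := 0) (b := x) (C := B)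
      (f := fun y => 1 / (V s y * density s y) * innerInt s h y)
      (by rw [uIoc_of_le hx.le]; exact hB)
    rwa [sub_zero, abs_of_pos hx] at this

lemma IsKernel.hasDerivAt_outerInt (hk : IsKernel s W) (hs : 0 < s)
    (hm : AEMeasurable h (volume.restrict (Ioi 0))) (hM : ∀ x, 0 < x → |h x| ≤ M) {x : ℝ}
    (hx : 0 < x)
    (hi : IntervalIntegrable (fun y => 1 / (V s y * density s y) * innerInt s h y) volume 0 x) :
    HasDerivAt (outerInt s h) (1 / (V s x * density s x) * innerInt s h x) x := by
  have hc := hk.continuousOn_outer_integrand hs hm hM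
  exact intervalIntegral.integral_hasDerivAt_right hi
    (hc.stronglyMeasurableAtFilter isOpen_Ioi x hx) (hc.continuousAt (Ioi_mem_nhds hx))

lemma IsKernel.hasDerivAt_steinSol (hk : IsKernel s W) (hs : 0 < s)
    (hm : AEMeasurable h (volume.restrict (Ioi 0))) (hM : ∀ x, 0 < x → |h x| ≤ M) {x : ℝ}
    (hx : 0 < x)
    (hi : IntervalIntegrable (fun y => 1 / (V s y * density s y) * innerInt s h y) volume 0 x) :
    HasDerivAt (steinSol s h) (derivSol s W h x) x := by
  have h1 := ((hk.hasDerivAt x hx).fun_mul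
    (hk.hasDerivAt_outerInt hs hm hM hx hi)).const_mul (1 / s)
  have hfun : steinSol s h = fun y => 1 / s * (V s y * outerInt s h y) :=
    funext fun y => mul_assoc _ _ _
  rw [hfun]
  refine h1.congr_deriv ?_
  have hV := (hk.pos x hx).ne'
  have hd := (hk.density_pos hs hx).ne'
  rw [derivSol]
  field_simp

lemma IsKernel.locAC_derivSol (hk : IsKernel s W) (hs : 0 < s)
    (hm : AEMeasurable h (volume.restrict (Ioi 0))) (hM : ∀ x, 0 < x → |h x| ≤ M)
    (hi : ∀ x, 0 < x →
      IntervalIntegrable (fun y => 1 / (V s y * density s y) * innerInt s h y) volume 0 x) :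
    LocAC (derivSol s W h) := by
  have hW : LocAC W := LocAC.of_hasDerivAt hk.hasDerivAt' (by
    refine ContinuousOn.div_const ?_ s
    exact (continuousOn_id.mul hk.continuousOn_deriv).add
      (continuousOn_const.mul hk.continuousOn_V))
  have hG : LocAC (outerInt s h) := LocAC.of_hasDerivAt
    (fun x hx => hk.hasDerivAt_outerInt hs hm hM hx (hi x hx))
    (hk.continuousOn_outer_integrand hs hm hM)
  have hinv : LocAC fun x => (density s x)⁻¹ := LocAC.of_hasDerivAt
    (fun x hx => (hk.hasDerivAt_density hx).inv (hk.density_pos hs hx).ne') (by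
      refine ContinuousOn.div ?_ (hk.continuousOn_density.pow 2) fun x hx =>
        pow_ne_zero 2 (hk.density_pos hs hx).ne'
      refine ContinuousOn.neg (ContinuousOn.mul (Continuous.continuousOn (by fun_prop)) ?_)
      exact hk.continuousOn_deriv.sub
        ((Continuous.continuousOn (by fun_prop)).mul hk.continuousOn_V))
  exact ((hW.mul hG).add ((hk.locAC_innerInt hs hm hM).mul hinv)).const_mul (1 / s)

/-- The terms carrying the outer integral cancel because V_s solves the homogeneous equation. Those
carrying the inner integral cancel because κ_s is a multiple of e^{-x²/(2s)} V_s. The derivative of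
the inner integral leaves the centred h. -/
lemma IsKernel.stein_equation (hk : IsKernel s W) (hs : 0 < s)
    (hm : AEMeasurable h (volume.restrict (Ioi 0))) (hM : ∀ x, 0 < x → |h x| ≤ M)
    (hi : ∀ x, 0 < x →
      IntervalIntegrable (fun y => 1 / (V s y * density s y) * innerInt s h y) volume 0 x) :
    ∀ᵐ x, 0 < x → s * deriv (derivSol s W h) x - x * derivSol s W h x -
      2 * (s - 1) * steinSol s h x = h x - mean s h := by
  filter_upwards [hk.ae_hasDerivAt_innerInt hs hm hM] with x hQ hx
  have hd0 := (hk.density_pos hs hx).ne'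
  have hV0 := (hk.pos x hx).ne'
  have hd := (((hk.hasDerivAt' x hx).fun_mul (hk.hasDerivAt_outerInt hs hm hM hx (hi x hx))).fun_add
    ((hQ hx).fun_div (hk.hasDerivAt_density hx) hd0)).const_mul (1 / s)
  have hd' : deriv (derivSol s W h) x = _ := hd.deriv
  have hf : steinSol s h x = 1 / s * V s x * outerInt s h x := rfl
  have hE : normConst s * Real.exp (-x ^ 2 / (2 * s)) = density s x / V s x := by
    rw [density_eq]
    field_simp
  rw [hd', hf, hE, derivSol]
  field_simp
  ring

end Kernel

/-! ### The Stein solution for s ≥ 1: linear growth, behaviour at zero, first residual. -/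

lemma IsKernel.antitoneOn {s : ℝ} {W : ℝ → ℝ} (hk : IsKernel s W) (hW : ∀ x, 0 < x → W x ≤ 0) :
    AntitoneOn (V s) (Ioi 0) :=
  antitoneOn_of_deriv_nonpos (convex_Ioi 0) hk.continuousOn_V
    (fun x hx => (hk.hasDerivAt x (interior_subset hx)).differentiableAt.differentiableWithinAt)
    fun x hx => by
      rw [(hk.hasDerivAt x (interior_subset hx)).deriv]
      exact hW x (interior_subset hx)

/-- Bounds on the integrand of the outer integral when `V_s` is decreasing. -/
lemma IsKernel.abs_innerInt_div_density_le {s : ℝ} {W h : ℝ → ℝ} {M : ℝ} (hk : IsKernel s W)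
    (hs : 0 < s) (hW : ∀ x, 0 < x → W x ≤ 0) (hm : AEMeasurable h (volume.restrict (Ioi 0)))
    (hM : ∀ x, 0 < x → |h x| ≤ M) {y : ℝ} (hy : 0 < y) :
    |innerInt s h y| / density s y ≤ M * √(2 * Real.pi * s) := by
  have hM0 : 0 ≤ M := (abs_nonneg _).trans (hM 1 one_pos)
  have hanti := hk.antitoneOn hW
  rw [div_le_iff₀ (hk.density_pos hs hy)]
  refine (hk.abs_innerInt_le_tail hs hm hM hy).trans ?_
  -- Since V_s decreases, the tail of κ_s is at most V_s(y) times a Gaussian tail, so V_s(y) cancels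
  -- on division by κ_s(y).
  have h1 : ∫ t in Ioi y, density s t ≤
      normConst s * V s y * ∫ t in Ioi y, Real.exp (-t ^ 2 / (2 * s)) := by
    rw [← integral_const_mul]
    refine setIntegral_mono_on (hk.integrable.mono_set (Ioi_subset_Ioi hy.le))
      ((integrableOn_gauss hs y).const_mul _) measurableSet_Ioi fun t ht => ?_
    have h2 := hanti (mem_Ioi.2 hy) (mem_Ioi.2 (hy.trans ht)) (le_of_lt ht)
    have h3 := normConst_pos hs
    rw [density_eq]
    calc _ ≤ normConst s * Real.exp (-t ^ 2 / (2 * s)) * V s y := by gcongr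
      _ = _ := by ring
  have h4 := mul_pos (normConst_pos hs) (hk.pos y hy)
  calc _ ≤ 2 * M * (normConst s * V s y *
        (Real.exp (-y ^ 2 / (2 * s)) * (√(2 * Real.pi * s) / 2))) := by
        refine mul_le_mul_of_nonneg_left (h1.trans ?_) (by positivity)
        exact mul_le_mul_of_nonneg_left (integral_gauss_Ioi_le hs hy.le) h4.le
    _ = _ := by rw [density_eq]; ring

section SteinSolution

variable {s M : ℝ} {W h : ℝ → ℝ}

/-- The integrand of the outer integral when `V_s` is decreasing. -/
lemma IsKernel.abs_outer_integrand_le (hk : IsKernel s W) (hs : 0 < s)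
    (hW : ∀ x, 0 < x → W x ≤ 0) (hm : AEMeasurable h (volume.restrict (Ioi 0)))
    (hM : ∀ x, 0 < x → |h x| ≤ M) {x y : ℝ} (hy : y ∈ Ioc 0 x) :
    |1 / (V s y * density s y) * innerInt s h y| ≤ M * √(2 * Real.pi * s) / V s x := by
  have hM0 : 0 ≤ M := (abs_nonneg _).trans (hM 1 one_pos)
  have hx : 0 < x := hy.1.trans_le hy.2
  have hVy := hk.pos y hy.1
  have hVx := hk.pos x hx
  have hd := hk.density_pos hs hy.1
  have h1 := hk.abs_innerInt_div_density_le hs hW hm hM hy.1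
  have h2 := hk.antitoneOn hW (mem_Ioi.2 hy.1) (mem_Ioi.2 hx) hy.2
  rw [abs_mul, abs_of_pos (by positivity)]
  calc 1 / (V s y * density s y) * |innerInt s h y|
      = |innerInt s h y| / density s y / V s y := by field_simp
    _ ≤ M * √(2 * Real.pi * s) / V s y := by gcongr
    _ ≤ M * √(2 * Real.pi * s) / V s x := by gcongr

/-- On (0,x] the outer integrand is at most a constant over V_s(x), as V_s decreases; the factor
V_s(x) in front cancels this. The linear bound gives both the growth condition and f(0+) = 0. -/
lemma IsKernel.abs_steinSol_le (hk : IsKernel s W) (hs : 0 < s)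
    (hW : ∀ x, 0 < x → W x ≤ 0) (hm : AEMeasurable h (volume.restrict (Ioi 0)))
    (hM : ∀ x, 0 < x → |h x| ≤ M) {x : ℝ} (hx : 0 < x) :
    |steinSol s h x| ≤ 1 / s * (M * √(2 * Real.pi * s)) * x := by
  have h1 := (hk.intervalIntegrable_outer hs hm hM hx
    fun y hy => hk.abs_outer_integrand_le hs hW hm hM hy).2
  have hVx := hk.pos x hx
  have hf : steinSol s h x = 1 / s * V s x * outerInt s h x := rfl
  rw [hf, abs_mul, abs_of_pos (by positivity)]
  calc _ ≤ 1 / s * V s x * (M * √(2 * Real.pi * s) / V s x * x) := by gcongr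
    _ = _ := by field_simp

lemma IsKernel.tendsto_innerInt_zero (hk : IsKernel s W) (hs : 0 < s)
    (hm : AEMeasurable h (volume.restrict (Ioi 0))) (hM : ∀ x, 0 < x → |h x| ≤ M) :
    Tendsto (innerInt s h) (𝓝[>] 0) (𝓝 0) := by
  have hc := (hk.integrable_indicator hs hm hM).continuous_primitive 0
  have h1 : Tendsto (fun y => ∫ t in (0 : ℝ)..y,
      (Ioi (0 : ℝ)).indicator (fun t => (h t - mean s h) * density s t) t) (𝓝[>] 0) (𝓝 0) := by
    have := (hc.tendsto 0).mono_left (nhdsWithin_le_nhds (s := Ioi 0))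
    simpa using this
  refine h1.congr' ?_
  filter_upwards [self_mem_nhdsWithin] with y hy using (innerInt_eq (le_of_lt hy)).symm

/-- Near 0 the outer integral is O(x) while V_s' is bounded, and the inner integral tends to 0 while
κ_s is bounded below. This is the boundary condition that starts the odd orders. -/
lemma IsKernel.tendsto_derivSol_zero (hk : IsKernel s W) (hs : 0 < s)
    (hW : ∀ x, 0 < x → W x ≤ 0) {K : ℝ} (hK : ∀ x, 0 < x → |W x| ≤ K)
    (hm : AEMeasurable h (volume.restrict (Ioi 0)))
    (hM : ∀ x, 0 < x → |h x| ≤ M) : Tendsto (derivSol s W h) (𝓝[>] 0) (𝓝 0) := by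
  have hM0 : 0 ≤ M := (abs_nonneg _).trans (hM 1 one_pos)
  have hK0 : 0 ≤ K := (abs_nonneg _).trans (hK 1 one_pos)
  have hV1 := hk.pos 1 one_pos
  have hc := normConst_pos hs
  set B : ℝ := M * √(2 * Real.pi * s) / V s 1 with hB
  set κ : ℝ := normConst s * Real.exp (-1 ^ 2 / (2 * s)) * V s 1 with hκ
  have hκ0 : 0 < κ := by positivity
  have hlim : Tendsto (fun x => 1 / s * (K * (B * x) + |innerInt s h x| / κ)) (𝓝[>] 0) (𝓝 0) := by
    have h1 : Tendsto (fun x : ℝ => K * (B * x)) (𝓝[>] 0) (𝓝 (K * (B * 0))) :=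
      (Continuous.tendsto (by fun_prop) 0).mono_left nhdsWithin_le_nhds
    have h2 := (hk.tendsto_innerInt_zero hs hm hM).abs.div_const κ
    simpa using (h1.add h2).const_mul (1 / s)
  refine squeeze_zero_norm' ?_ hlim
  filter_upwards [Ioo_mem_nhdsGT (one_pos : (0 : ℝ) < 1)] with x hx
  have hV : V s 1 ≤ V s x := hk.antitoneOn hW hx.1 (mem_Ioi.2 one_pos) hx.2.le
  have hG : |outerInt s h x| ≤ B * x :=
    (hk.intervalIntegrable_outer hs hm hM hx.1 fun y hy =>
      (hk.abs_outer_integrand_le hs hW hm hM hy).trans (by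
        have : 0 ≤ M * √(2 * Real.pi * s) := by positivity
        rw [hB]
        gcongr)).2
  have hκx : κ ≤ density s x := by
    have : x ^ 2 ≤ 1 ^ 2 := pow_le_pow_left₀ hx.1.le hx.2.le 2
    rw [density_eq, hκ]
    gcongr
  rw [derivSol, norm_mul, Real.norm_of_nonneg (by positivity)]
  refine mul_le_mul_of_nonneg_left ((norm_add_le _ _).trans (add_le_add ?_ ?_)) (by positivity)
  · rw [norm_mul]
    exact mul_le_mul (hK x hx.1) hG (norm_nonneg _) hK0
  · rw [norm_div, Real.norm_of_nonneg (hκ0.le.trans hκx)]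
    exact div_le_div_of_nonneg_left (norm_nonneg _) hκ0 hκx

/-- The Stein solution and its first derivative for `s ≥ 1`. -/
theorem steinSol_of_one_le (hs : 1 ≤ s) (hm : AEMeasurable h (volume.restrict (Ioi 0)))
    (hM : ∀ x, 0 < x → |h x| ≤ M) :
    ∃ u : ℝ → ℝ, (∀ x, 0 < x → HasDerivAt (steinSol s h) (u x) x) ∧ LocAC u ∧
      (∀ᵐ x, 0 < x → s * deriv u x - x * u x - 2 * (s - 1) * steinSol s h x = h x - mean s h) ∧
      Tendsto (steinSol s h) (𝓝[>] 0) (𝓝 0) ∧ Tendsto u (𝓝[>] 0) (𝓝 0) ∧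
      (∃ B, ∀ x, 0 < x → |steinSol s h x| ≤ B * x) ∧ |mean s h| ≤ M ∧
      ∀ᵐ x, 0 < x → |s * deriv u x - x * u x| ≤ 2 * M := by
  have hs0 : 0 < s := by linarith
  obtain ⟨W, hk, hW, K, hK⟩ := exists_isKernel_of_one_le hs
  have hi : ∀ x, 0 < x → IntervalIntegrable
      (fun y => 1 / (V s y * density s y) * innerInt s h y) volume 0 x := fun x hx =>
    (hk.intervalIntegrable_outer hs0 hm hM hx
      fun y hy => hk.abs_outer_integrand_le hs0 hW hm hM hy).1
  have hder : ∀ x, 0 < x → HasDerivAt (steinSol s h) (derivSol s W h x) x :=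
    fun x hx => hk.hasDerivAt_steinSol hs0 hm hM hx (hi x hx)
  have hac := hk.locAC_derivSol hs0 hm hM hi
  have hode := hk.stein_equation hs0 hm hM hi
  have hgrow := fun x hx => hk.abs_steinSol_le hs0 hW hm hM (x := x) hx
  have hmean := abs_le.1 (hk.abs_mean_le hs0 hM)
  have hM0 : 0 ≤ M := (abs_nonneg _).trans (hM 1 one_pos)
  have hzero : Tendsto (steinSol s h) (𝓝[>] 0) (𝓝 0) := by
    refine squeeze_zero_norm' (a := fun x => 1 / s * (M * √(2 * Real.pi * s)) * x) ?_ ?_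
    · filter_upwards [self_mem_nhdsWithin] with x hx using hgrow x hx
    · have : Tendsto (fun x : ℝ => 1 / s * (M * √(2 * Real.pi * s)) * x) (𝓝[>] 0)
          (𝓝 (1 / s * (M * √(2 * Real.pi * s)) * 0)) :=
        (Continuous.tendsto (by fun_prop) 0).mono_left nhdsWithin_le_nhds
      simpa using this
  -- The two one-sided bounds are kept asymmetric in the mean: adding the centred h, the mean
  -- cancels and the residual is at most 2M instead of 4M.
  have hcf : ∀ x, 0 < x → 2 * (s - 1) * steinSol s h x ≤ M + mean s h ∧
      -(M - mean s h) ≤ 2 * (s - 1) * steinSol s h x := by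
    -- For s = 1 the zeroth-order coefficient vanishes, so the maximum principle does not apply;
    -- both inequalities then reduce to |mean| ≤ M.
    rcases hs.eq_or_lt with rfl | hs1
    · intro x _
      constructor <;> linarith
    have hc : 0 < 2 * (s - 1) := by linarith
    intro x hx
    have hd1 : 0 ≤ (M + mean s h) / (2 * (s - 1)) := div_nonneg (by linarith) hc.le
    have hd2 : 0 ≤ (M - mean s h) / (2 * (s - 1)) := div_nonneg (by linarith) hc.le
    constructor
    · have := le_of_maximum_principle (r := M + mean s h) (d := (M + mean s h) / (2 * (s - 1)))
        (A := 0) (B := 1 / s * (M * √(2 * Real.pi * s))) hs0 hc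
        (by rw [mul_div_cancel₀ _ hc.ne']) le_rfl hd1 hder hac (by
          filter_upwards [hode] with y hy hy0
          rw [hy hy0]
          linarith [(abs_le.1 (hM y hy0)).1])
        (fun y hy => by rw [zero_add]; exact (le_abs_self _).trans (hgrow y hy))
        (fun ε hε => by
          filter_upwards [hzero.eventually_lt_const hε] with y hy
          linarith) hx
      rwa [le_div_iff₀ hc, mul_comm] at this
    · have := le_of_maximum_principle (r := M - mean s h) (d := (M - mean s h) / (2 * (s - 1)))
        (A := 0) (B := 1 / s * (M * √(2 * Real.pi * s))) (g := fun y => -steinSol s h y)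
        (u := fun y => -derivSol s W h y) hs0 hc
        (by rw [mul_div_cancel₀ _ hc.ne']) le_rfl hd2 (fun y hy => (hder y hy).fun_neg) hac.neg (by
          filter_upwards [hode] with y hy hy0
          rw [deriv.fun_neg]
          linarith [(abs_le.1 (hM y hy0)).2, hy hy0])
        (fun y hy => by rw [zero_add]; exact (neg_le_abs _).trans (hgrow y hy))
        (fun ε hε => by
          filter_upwards [hzero.eventually_const_lt (neg_lt_zero.2 hε)] with y hy
          linarith) hx
      rw [le_div_iff₀ hc] at this
      linarith
  refine ⟨derivSol s W h, hder, hac, hode, hzero, hk.tendsto_derivSol_zero hs0 hW hK hm hM,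
    ⟨_, hgrow⟩, abs_le.2 hmean, ?_⟩
  filter_upwards [hode] with x hx hx0
  have h1 := hx hx0
  have h2 := abs_le.1 (hM x hx0)
  have h3 := hcf x hx0
  exact abs_le.2 ⟨by linarith, by linarith⟩

/-! ### The Stein solution for s = 1/2. -/

/-- The tail of κ_{1/2} is exactly e^{-y²}, which gives the first bound. The quadratic one is needed
near 0, where V_s κ_s vanishes like 2y². -/
lemma half_inner_bounds (hm : AEMeasurable h (volume.restrict (Ioi 0)))
    (hM : ∀ x, 0 < x → |h x| ≤ M) {y : ℝ} (hy : 0 < y) :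
    |innerInt (1 / 2) h y| ≤ 2 * M * Real.exp (-y ^ 2 / (2 * (1 / 2))) ∧
    |innerInt (1 / 2) h y| ≤ 4 * M * y ^ 2 := by
  have hs : (0 : ℝ) < 1 / 2 := by norm_num
  have hM0 : 0 ≤ M := (abs_nonneg _).trans (hM 1 one_pos)
  constructor
  · refine (isKernel_half.abs_innerInt_le_tail hs hm hM hy).trans (le_of_eq ?_)
    rw [setIntegral_congr_fun measurableSet_Ioi fun x hx => density_half (hy.trans hx),
      integral_const_mul, (integral_mul_gauss_Ioi hs hy.le).2]
    ring
  · refine (isKernel_half.abs_innerInt_le hs hM hy).trans ?_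
    have h1 : ‖∫ t in Ioc 0 y, density (1 / 2) t‖ ≤ 2 * y * volume.real (Ioc 0 y) := by
      refine norm_setIntegral_le_of_norm_le_const (by simp) fun t ht => ?_
      rw [Real.norm_of_nonneg (isKernel_half.density_pos hs ht.1).le, density_half ht.1]
      have : Real.exp (-t ^ 2 / (2 * (1 / 2))) ≤ 1 := by
        rw [Real.exp_le_one_iff]
        exact div_nonpos_of_nonpos_of_nonneg (neg_nonpos.2 (sq_nonneg t)) (by norm_num)
      nlinarith [ht.1, ht.2, Real.exp_pos (-t ^ 2 / (2 * (1 / 2)))]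
    rw [Measure.real, Real.volume_Ioc, sub_zero, ENNReal.toReal_ofReal hy.le] at h1
    calc _ ≤ 2 * M * (2 * y * y) :=
          mul_le_mul_of_nonneg_left ((le_abs_self _).trans h1) (by positivity)
      _ = _ := by ring

/-- The Stein solution and its first derivative for `s = 1/2`. -/
theorem steinSol_half (hm : AEMeasurable h (volume.restrict (Ioi 0)))
    (hM : ∀ x, 0 < x → |h x| ≤ M) :
    ∃ u : ℝ → ℝ, (∀ x, 0 < x → HasDerivAt (steinSol (1 / 2) h) (u x) x) ∧ LocAC u ∧
      (∀ᵐ x, 0 < x → 1 / 2 * deriv u x - x * u x - 2 * (1 / 2 - 1) * steinSol (1 / 2) h x =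
        h x - mean (1 / 2) h) ∧
      ∀ᵐ x, 0 < x → |deriv u x| ≤ 8 * M := by
  have hs : (0 : ℝ) < 1 / 2 := by norm_num
  have hM0 : 0 ≤ M := (abs_nonneg _).trans (hM 1 one_pos)
  have hk := isKernel_half
  have hi : ∀ x, 0 < x → IntervalIntegrable
      (fun y => 1 / (V (1 / 2) y * density (1 / 2) y) * innerInt (1 / 2) h y) volume 0 x := by
    intro x hx
    -- Dividing 4M y² by V_s κ_s = 2y² e^{-y²} leaves 2M e^{y²}, largest at y = x.
    refine (hk.intervalIntegrable_outer hs hm hM hx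
      (B := 2 * M / Real.exp (-x ^ 2 / (2 * (1 / 2)))) fun y hy => ?_).1
    have hy0 : 0 < y := hy.1
    have hE : Real.exp (-x ^ 2 / (2 * (1 / 2))) ≤ Real.exp (-y ^ 2 / (2 * (1 / 2))) := by
      have : y ^ 2 ≤ x ^ 2 := pow_le_pow_left₀ hy.1.le hy.2 2
      gcongr
    rw [V_half hy0, density_half hy0, abs_mul, abs_of_pos (by positivity)]
    calc _ ≤ 1 / (y * (2 * (y * Real.exp (-y ^ 2 / (2 * (1 / 2)))))) * (4 * M * y ^ 2) :=
          mul_le_mul_of_nonneg_left (half_inner_bounds hm hM hy0).2 (by positivity)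
      _ = 2 * M / Real.exp (-y ^ 2 / (2 * (1 / 2))) := by
          set e := Real.exp (-y ^ 2 / (2 * (1 / 2)))
          have : e ≠ 0 := (Real.exp_pos _).ne'
          field_simp
          ring
      _ ≤ _ := by gcongr
  have hode := hk.stein_equation hs hm hM hi
  refine ⟨derivSol (1 / 2) (fun _ => 1) h,
    fun x hx => hk.hasDerivAt_steinSol hs hm hM hx (hi x hx),
    hk.locAC_derivSol hs hm hM hi, hode, ?_⟩
  filter_upwards [hode] with x hx hx0
  have h1 := hx hx0
  have h2 := abs_le.1 (hk.abs_sub_mean_le hs hM hx0)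
  -- With V_s(x) = x the outer integral drops out of x f' - f. The Stein equation then gives |f''|/2
  -- ≤ 2M + 2M.
  have h3 : x * derivSol (1 / 2) (fun _ => 1) h x - steinSol (1 / 2) h x =
      innerInt (1 / 2) h x / Real.exp (-x ^ 2 / (2 * (1 / 2))) := by
    have hf : steinSol (1 / 2) h x = 1 / (1 / 2) * V (1 / 2) x * outerInt (1 / 2) h x := rfl
    rw [hf, derivSol, V_half hx0, density_half hx0]
    set e := Real.exp (-x ^ 2 / (2 * (1 / 2)))
    have : e ≠ 0 := (Real.exp_pos _).ne'
    field_simp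
    ring
  have h4 : |innerInt (1 / 2) h x / Real.exp (-x ^ 2 / (2 * (1 / 2)))| ≤ 2 * M := by
    rw [abs_div, abs_of_pos (Real.exp_pos _), div_le_iff₀ (Real.exp_pos _)]
    exact (half_inner_bounds hm hM hx0).1
  have h5 := abs_le.1 h4
  exact abs_le.2 ⟨by linarith, by linarith⟩

end SteinSolution

/-! ### Nesting of the classes of test functions. -/

section Classes

variable {h : ℝ → ℝ}

/-- The next derivative is bounded, so the lower one is locally Lipschitz and hence absolutely
continuous. For m = 0 continuity supplies measurability. -/
lemma MemCb.of_succ {m : ℕ} (hh : MemCb (m + 1) h) : MemCb m h := by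
  refine ⟨?_, fun j hj => hh.2 j (by omega)⟩
  cases m with
  | zero =>
    have h1 : LocAC (iteratedDeriv 0 h) := hh.1.2
    rw [iteratedDeriv_zero] at h1
    exact h1.continuousOn.aemeasurable measurableSet_Ioi
  | succ k =>
    refine ⟨fun j hj => hh.1.1 j (by omega), ?_⟩
    refine LocAC.of_bounded_deriv
      (fun x hx => (hh.1.1 k (by omega)).differentiableAt (Ioi_mem_nhds hx)) fun a b ha hb => ?_
    obtain ⟨M, hM⟩ := hh.2 (k + 1) (by omega)
    refine ⟨M, fun x hx => ?_⟩
    rw [← iteratedDeriv_succ]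
    exact hM x (uIcc_subset_Ioi_zero ha hb hx)

lemma MemCb.mono {m n : ℕ} (hmn : n ≤ m) (hh : MemCb m h) : MemCb n h := by
  induction m, hmn using Nat.le_induction with
  | base => exact hh
  | succ k _ ih => exact ih hh.of_succ

lemma MemCb.locAC {m : ℕ} (hh : MemCb (m + 1) h) : LocAC (iteratedDeriv m h) := hh.1.2

lemma MemCb.abs_le_supNorm {m j : ℕ} (hh : MemCb m h) (hj : j ≤ m) {x : ℝ} (hx : 0 < x) :
    |iteratedDeriv j h x| ≤ supNorm (iteratedDeriv j h) := by
  obtain ⟨M, hM⟩ := hh.2 j hj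
  exact le_ciSup (f := fun y : Ioi (0 : ℝ) => |iteratedDeriv j h y|)
    ⟨M, by rintro _ ⟨y, rfl⟩; exact hM y y.2⟩ ⟨x, hx⟩

lemma supNorm_nonneg (g : ℝ → ℝ) : 0 ≤ supNorm g := Real.iSup_nonneg fun _ => abs_nonneg _

end Classes

/-! ### Bootstrapping regularity and the differentiated Stein equations. -/

/-- The right-hand side of the Stein equation differentiated `j` times. -/
def steinRhs (s : ℝ) (h : ℝ → ℝ) (j : ℕ) (x : ℝ) : ℝ :=
  iteratedDeriv j h x - if j = 0 then mean s h else 0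

lemma steinRhs_zero (s : ℝ) (h : ℝ → ℝ) (x : ℝ) : steinRhs s h 0 x = h x - mean s h := by
  simp [steinRhs]

lemma steinRhs_of_pos (s : ℝ) (h : ℝ → ℝ) {j : ℕ} (hj : j ≠ 0) (x : ℝ) :
    steinRhs s h j x = iteratedDeriv j h x := by
  simp [steinRhs, hj]

/-- Regularity of a function `f` up to order `m + 1`, together with the Stein equation
differentiated up to `m` times. -/
structure SteinRegular (s : ℝ) (h f : ℝ → ℝ) (m : ℕ) : Prop where
  hasDerivAt : ∀ j ≤ m, ∀ x, 0 < x → HasDerivAt (iteratedDeriv j f) (iteratedDeriv (j + 1) f x) x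
  locAC : LocAC (iteratedDeriv (m + 1) f)
  eq_of_lt : ∀ j < m, ∀ x, 0 < x → s * iteratedDeriv (j + 2) f x =
    x * iteratedDeriv (j + 1) f x + (2 * s - 2 + j) * iteratedDeriv j f x + steinRhs s h j x
  ae_eq : ∀ᵐ x, 0 < x → s * iteratedDeriv (m + 2) f x =
    x * iteratedDeriv (m + 1) f x + (2 * s - 2 + m) * iteratedDeriv m f x + steinRhs s h m x

section Regularity

variable {s : ℝ} {h f : ℝ → ℝ}

lemma eventuallyEq_of_eq_on_pos {u v : ℝ → ℝ} (huv : ∀ x, 0 < x → u x = v x) {x : ℝ}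
    (hx : 0 < x) : u =ᶠ[𝓝 x] v := by
  filter_upwards [Ioi_mem_nhds hx] with y hy using huv y hy

lemma SteinRegular.base {u : ℝ → ℝ} (hu : ∀ x, 0 < x → HasDerivAt f (u x) x) (hac : LocAC u)
    (hode : ∀ᵐ x, 0 < x → s * deriv u x - x * u x - 2 * (s - 1) * f x = h x - mean s h) :
    SteinRegular s h f 0 := by
  have h1 : ∀ x, 0 < x → u x = iteratedDeriv 1 f x := fun x hx => by
    rw [iteratedDeriv_one, (hu x hx).deriv]
  refine ⟨fun j hj x hx => ?_, hac.congr h1, fun j hj => absurd hj (by omega), ?_⟩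
  · obtain rfl : j = 0 := by omega
    rw [iteratedDeriv_zero, zero_add, ← h1 x hx]
    exact hu x hx
  · filter_upwards [hode] with x hx hx0
    rw [zero_add, zero_add, iteratedDeriv_succ, ← (eventuallyEq_of_eq_on_pos h1 hx0).deriv_eq,
      ← h1 x hx0, steinRhs_zero, iteratedDeriv_zero]
    push_cast
    linarith [hx hx0]

lemma locAC_id : LocAC fun x => x :=
  LocAC.of_hasDerivAt (fun x _ => hasDerivAt_id x) continuousOn_const

lemma locAC_const (c : ℝ) : LocAC fun _ => c :=
  LocAC.of_hasDerivAt (fun x _ => hasDerivAt_const x c) continuousOn_const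

/-- When h^{(m)} is locally absolutely continuous, the order-m equation expresses f^{(m+2)} a.e. by
a continuous, indeed locally absolutely continuous, function G. Then f^{(m+1)} is differentiable
everywhere with derivative G, and differentiating G a.e. gives the next equation. -/
lemma SteinRegular.succ (hs : 0 < s) {m : ℕ} (hf : SteinRegular s h f m)
    (hh : MemCb (m + 1) h) : SteinRegular s h f (m + 1) := by
  set G : ℝ → ℝ := fun x => (1 / s) * (x * iteratedDeriv (m + 1) f x +
    (2 * s - 2 + m) * iteratedDeriv m f x + steinRhs s h m x) with hG
  have hH : LocAC (steinRhs s h m) := hh.locAC.sub (locAC_const _)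
  have hFm : LocAC (iteratedDeriv m f) :=
    LocAC.of_hasDerivAt (hf.hasDerivAt m le_rfl) hf.locAC.continuousOn
  have hGac : LocAC G :=
    (((locAC_id.mul hf.locAC).add (hFm.const_mul _)).add hH).const_mul _
  have hder : ∀ x, 0 < x → HasDerivAt (iteratedDeriv (m + 1) f) (G x) x := fun x hx => by
    refine hf.locAC.hasDerivAt_of_ae_eq hGac.continuousOn ?_ hx
    filter_upwards [hf.ae_eq] with y hy hy0
    rw [← iteratedDeriv_succ, hG]
    have := hy hy0
    field_simp
    linarith
  have hGeq : ∀ x, 0 < x → G x = iteratedDeriv (m + 2) f x := fun x hx => by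
    rw [iteratedDeriv_succ, (hder x hx).deriv]
  refine ⟨fun j hj x hx => ?_, hGac.congr hGeq, fun j hj x hx => ?_, ?_⟩
  · rcases Nat.le_succ_iff.1 hj with hj | rfl
    · exact hf.hasDerivAt j hj x hx
    · rw [← hGeq x hx]
      exact hder x hx
  · rcases Nat.lt_succ_iff_lt_or_eq.1 hj with hj | rfl
    · exact hf.eq_of_lt j hj x hx
    · rw [← hGeq x hx, hG]
      field_simp
  · filter_upwards [hh.locAC.ae_differentiableAt] with x hx hx0
    have h1 : HasDerivAt (steinRhs s h m) (iteratedDeriv (m + 1) h x) x := by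
      rw [iteratedDeriv_succ]
      exact (hx hx0).hasDerivAt.sub_const _
    have h2 : HasDerivAt (iteratedDeriv (m + 1) f) (iteratedDeriv (m + 2) f x) x := by
      rw [← hGeq x hx0]
      exact hder x hx0
    have h3 := ((((hasDerivAt_id x).fun_mul h2).fun_add
      ((hf.hasDerivAt m le_rfl x hx0).const_mul (2 * s - 2 + m))).fun_add h1).const_mul (1 / s)
    have h4 : deriv G x = _ := h3.deriv
    rw [iteratedDeriv_succ, ← (eventuallyEq_of_eq_on_pos hGeq hx0).deriv_eq, h4,
      steinRhs_of_pos s h (by omega)]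
    simp only [id]
    push_cast
    field_simp
    ring

lemma SteinRegular.of_memCb (hs : 0 < s) (hf : SteinRegular s h f 0) {m : ℕ}
    (hh : MemCb m h) : SteinRegular s h f m := by
  induction m with
  | zero => exact hf
  | succ k ih => exact (ih hh.of_succ).succ hs hh

lemma SteinRegular.hasACDeriv {m : ℕ} (hf : SteinRegular s h f m) : HasACDeriv (m + 2) f :=
  ⟨fun j hj x hx => (hf.hasDerivAt j (by omega) x hx).differentiableAt.differentiableWithinAt,
    hf.locAC⟩

/-- Bounds on the two highest derivatives in the Stein equation differentiated `n` times. -/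
lemma SteinRegular.abs_le (hs : 0 < s) {n : ℕ} (hf : SteinRegular s h f n) {r A B : ℝ}
    (hR : ∀ᵐ x, 0 < x → |s * iteratedDeriv (n + 2) f x - x * iteratedDeriv (n + 1) f x| ≤ r)
    (hgrow : ∀ x, 0 < x → |iteratedDeriv n f x| ≤ A + B * x) {x : ℝ} (hx : 0 < x) :
    |iteratedDeriv (n + 1) f x| ≤ r / s * (√(2 * Real.pi * s) / 2) ∧
      |iteratedDeriv (n + 2) f x| ≤ 2 * r / s := by
  have key := fun y (hy : 0 < y) => abs_le_of_growth hs (hf.hasDerivAt n le_rfl) hf.locAC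
    (by simpa only [← iteratedDeriv_succ] using hR) hgrow hy
  refine ⟨(key x hx).1, ?_⟩
  rw [iteratedDeriv_succ]
  -- It suffices to argue a.e., where s|f^{(n+2)}| ≤ r + x|f^{(n+1)}| ≤ 2r.
  refine hf.locAC.abs_deriv_le ?_ hx
  filter_upwards [hR] with y hy hy0
  rw [← iteratedDeriv_succ, le_div_iff₀ hs]
  have h1 := _root_.abs_le.1 (hy hy0)
  have h2 := (key y hy0).2
  rw [← abs_of_pos hy0, ← abs_mul] at h2
  have h3 := _root_.abs_le.1 h2
  rw [abs_of_pos hy0] at h3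
  have h4 : |iteratedDeriv (n + 2) f y| * s = |s * iteratedDeriv (n + 2) f y| := by
    rw [abs_mul, abs_of_pos hs, mul_comm]
  rw [h4]
  exact _root_.abs_le.2 ⟨by linarith, by linarith⟩

end Regularity

/-! ### Boundary values at zero and the maximum principle at every order, s ≥ 1. -/

/-- Bounds for `(2s - 2 + n) |f⁽ⁿ⁾(0+)|` in terms of bounds `η j` for `|h⁽ʲ⁾|`. -/
def boundaryBound (η : ℕ → ℝ) : ℕ → ℝ
  | 0 => η 0
  | 1 => 0
  | n + 2 => (n + 2) * (boundaryBound η n + η n)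

lemma boundaryBound_nonneg {η : ℕ → ℝ} (hη : ∀ n, 0 ≤ η n) (n : ℕ) : 0 ≤ boundaryBound η n := by
  induction n using Nat.twoStepInduction with
  | zero => exact hη 0
  | one => exact le_rfl
  | more n ih _ =>
    have := hη n
    rw [boundaryBound]
    positivity

/-- The bounds obtained at order `n` for the Stein solution, `s ≥ 1`. -/
structure SteinBounds (s : ℝ) (h f : ℝ → ℝ) (η : ℕ → ℝ) (n : ℕ) : Prop where
  abs_le : ∀ᵐ x, 0 < x → |s * iteratedDeriv (n + 2) f x - x * iteratedDeriv (n + 1) f x| ≤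
    η n + max (η n) (boundaryBound η n)
  growth : ∃ A B : ℝ, ∀ x, 0 < x → |iteratedDeriv n f x| ≤ A + B * x
  near_zero : ∀ ε > 0, ∀ᶠ x in 𝓝[>] (0 : ℝ),
    |(2 * s - 2 + n) * iteratedDeriv n f x + steinRhs s h n x| ≤ boundaryBound η n + η n + ε

section Bounds

variable {s : ℝ} {h f : ℝ → ℝ} {η : ℕ → ℝ}

/-- The maximum principle applied to f^{(n)} and -f^{(n)} with barrier max(η_n, D_n)/c, where D_n is
`boundaryBound η n` and c = 2s-2+n > 0. The first entry of the maximum serves the differential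
inequality, the second the boundary at 0. -/
lemma SteinBounds.of_near_zero (hs : 1 ≤ s) {n : ℕ} (hn : n ≠ 0) (hη : ∀ n, 0 ≤ η n)
    (hf : SteinRegular s h f n) (hh : ∀ x, 0 < x → |iteratedDeriv n h x| ≤ η n) {A : ℝ}
    (hgrow : ∀ x, 0 < x → |iteratedDeriv n f x| ≤ A)
    (hzero : ∀ ε > 0, ∀ᶠ x in 𝓝[>] (0 : ℝ),
      (2 * s - 2 + n) * |iteratedDeriv n f x| ≤ boundaryBound η n + ε) :
    SteinBounds s h f η n := by
  have hs0 : 0 < s := by linarith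
  have hn1 : (1 : ℝ) ≤ n := by exact_mod_cast Nat.one_le_iff_ne_zero.2 hn
  set c : ℝ := 2 * s - 2 + n with hc
  have hc0 : 0 < c := by linarith
  set m : ℝ := max (η n) (boundaryBound η n) with hm
  have hm0 : 0 ≤ m := (hη n).trans (le_max_left _ _)
  have hA0 : 0 ≤ A := (abs_nonneg _).trans (hgrow 1 one_pos)
  have hzero' : ∀ ε > 0, ∀ᶠ x in 𝓝[>] (0 : ℝ), |iteratedDeriv n f x| ≤ m / c + ε := by
    intro ε hε
    filter_upwards [hzero (c * ε) (by positivity)] with x hx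
    have h1 : boundaryBound η n ≤ m := le_max_right _ _
    refine le_of_mul_le_mul_left ?_ hc0
    rw [mul_add, mul_div_cancel₀ _ hc0.ne']
    linarith
  have hode : ∀ᵐ x, 0 < x → s * iteratedDeriv (n + 2) f x =
      x * iteratedDeriv (n + 1) f x + c * iteratedDeriv n f x + iteratedDeriv n h x := by
    filter_upwards [hf.ae_eq] with x hx hx0
    rw [hx hx0, steinRhs_of_pos s h hn]
  have hrd : η n ≤ c * (m / c) := by
    rw [mul_div_cancel₀ _ hc0.ne']
    exact le_max_left _ _
  have hd0 : 0 ≤ m / c := by positivity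
  have hbound : ∀ x, 0 < x → |c * iteratedDeriv n f x| ≤ m := by
    intro x hx
    have h1 := le_of_maximum_principle (A := A) (B := 0) hs0 hc0 hrd hA0 hd0
      (hf.hasDerivAt n le_rfl) hf.locAC (by
        filter_upwards [hode] with y hy hy0
        rw [← iteratedDeriv_succ]
        linarith [hy hy0, (_root_.abs_le.1 (hh y hy0)).1])
      (fun y hy => by rw [zero_mul, add_zero]; exact (le_abs_self _).trans (hgrow y hy))
      (fun ε hε => (hzero' ε hε).mono fun y hy => (le_abs_self _).trans hy) hx
    have h2 := le_of_maximum_principle (A := A) (B := 0) (g := fun y => -iteratedDeriv n f y)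
      (u := fun y => -iteratedDeriv (n + 1) f y) hs0 hc0 hrd hA0 hd0
      (fun y hy => (hf.hasDerivAt n le_rfl y hy).fun_neg) hf.locAC.neg (by
        filter_upwards [hode] with y hy hy0
        rw [deriv.fun_neg, ← iteratedDeriv_succ]
        linarith [hy hy0, (_root_.abs_le.1 (hh y hy0)).2])
      (fun y hy => by rw [zero_mul, add_zero]; exact (neg_le_abs _).trans (hgrow y hy))
      (fun ε hε => (hzero' ε hε).mono fun y hy => (neg_le_abs _).trans hy) hx
    rw [le_div_iff₀ hc0] at h1 h2
    exact _root_.abs_le.2 ⟨by linarith, by linarith⟩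
  refine ⟨?_, ⟨A, 0, fun x hx => by rw [zero_mul, add_zero]; exact hgrow x hx⟩, fun ε hε => ?_⟩
  · filter_upwards [hode] with x hx hx0
    have h1 : s * iteratedDeriv (n + 2) f x - x * iteratedDeriv (n + 1) f x =
        iteratedDeriv n h x + c * iteratedDeriv n f x := by linarith [hx hx0]
    rw [h1]
    exact (abs_add_le _ _).trans (add_le_add (hh x hx0) (hbound x hx0))
  · filter_upwards [hzero ε hε, self_mem_nhdsWithin] with x hx hx0
    rw [steinRhs_of_pos s h hn]
    have h1 := abs_add_le (c * iteratedDeriv n f x) (iteratedDeriv n h x)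
    rw [abs_mul, abs_of_pos hc0] at h1
    linarith [hh x hx0]

/-- All bounds for the Stein solution with `s ≥ 1`. -/
theorem steinBounds (hs : 1 ≤ s) {m n : ℕ} (hh : MemCb m h) (hn : n ≤ m) :
    SteinRegular s h (steinSol s h) n ∧
      SteinBounds s h (steinSol s h) (fun j => supNorm (iteratedDeriv j h)) n := by
  have hs0 : 0 < s := by linarith
  set η : ℕ → ℝ := fun j => supNorm (iteratedDeriv j h) with hηdef
  have hη : ∀ n, 0 ≤ η n := fun n => supNorm_nonneg _
  have hM : ∀ x, 0 < x → |h x| ≤ η 0 := fun x hx => by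
    have := hh.abs_le_supNorm (Nat.zero_le m) hx
    rwa [iteratedDeriv_zero] at this
  obtain ⟨u, hu, hac, hode, hf0, hu0, ⟨B, hB⟩, hmean, hR⟩ :=
    steinSol_of_one_le hs (hh.mono (Nat.zero_le m)).1 hM
  set f := steinSol s h with hf
  have hreg : ∀ j ≤ m, SteinRegular s h f j := fun j hj =>
    (SteinRegular.base hu hac hode).of_memCb hs0 (hh.mono hj)
  refine ⟨hreg n hn, ?_⟩
  have hu1 : ∀ x, 0 < x → u x = iteratedDeriv 1 f x := fun x hx => by
    rw [iteratedDeriv_one, (hu x hx).deriv]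
  have hbdd : ∀ j ≤ m, SteinBounds s h f η j →
      ∃ A, ∀ x, 0 < x → |iteratedDeriv (j + 1) f x| ≤ A := fun j hj hb => by
    obtain ⟨A, B, hAB⟩ := hb.growth
    exact ⟨_, fun x hx => ((hreg j hj).abs_le hs0 hb.abs_le hAB hx).1⟩
  -- Although f(0+) = 0, the order-zero boundary bound is η_0: the right-hand side is h minus its
  -- mean, of size at most 2η_0, and this entry accounts for the mean.
  have h0 : SteinBounds s h f η 0 := by
    refine ⟨?_, ⟨0, B, fun x hx => by simpa using hB x hx⟩, fun ε hε => ?_⟩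
    · filter_upwards [hR] with x hx hx0
      rw [zero_add, zero_add, iteratedDeriv_succ, ← (eventuallyEq_of_eq_on_pos hu1 hx0).deriv_eq,
        ← hu1 x hx0, boundaryBound, max_self]
      linarith [hx hx0]
    · have h1 : Tendsto (fun x => |(2 * s - 2 + (0 : ℕ)) * f x|) (𝓝[>] 0) (𝓝 0) := by
        simpa using (hf0.const_mul (2 * s - 2 + (0 : ℕ))).abs
      filter_upwards [h1.eventually_lt_const hε, self_mem_nhdsWithin] with x hx hx0
      rw [steinRhs_zero, iteratedDeriv_zero, boundaryBound]
      have h2 := abs_add_le ((2 * s - 2 + (0 : ℕ)) * f x) (h x - mean s h)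
      have h3 := abs_sub (h x) (mean s h)
      linarith [hM x hx0]
  induction n using Nat.twoStepInduction with
  | zero => exact h0
  | one =>
    obtain ⟨A, hA⟩ := hbdd 0 (by omega) h0
    refine SteinBounds.of_near_zero hs one_ne_zero hη (hreg 1 hn)
      (fun x hx => hh.abs_le_supNorm hn hx) hA fun ε hε => ?_
    have h1 : Tendsto (fun x => (2 * s - 2 + (1 : ℕ)) * |u x|) (𝓝[>] 0) (𝓝 0) := by
      simpa using hu0.abs.const_mul (2 * s - 2 + (1 : ℕ))
    filter_upwards [h1.eventually_lt_const hε, self_mem_nhdsWithin] with x hx hx0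
    rw [boundaryBound, zero_add, ← hu1 x hx0]
    exact hx.le
  | more n ih1 ih2 =>
    have hb := ih1 (by omega)
    obtain ⟨A1, hA1⟩ := hbdd n (by omega) hb
    obtain ⟨A2, hA2⟩ := hbdd (n + 1) (by omega) (ih2 (by omega))
    refine SteinBounds.of_near_zero hs (by omega) hη (hreg (n + 2) hn)
      (fun x hx => hh.abs_le_supNorm hn hx) hA2 fun ε hε => ?_
    have hn2 : (0 : ℝ) < n + 2 := by positivity
    -- As f^{(n+1)} is bounded, the term x f^{(n+1)} disappears at 0, and the order-n equation
    -- controls s f^{(n+2)} near 0 by order-n data.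
    have h1 : Tendsto (fun x : ℝ => x * A1) (𝓝[>] 0) (𝓝 0) := by
      have : Tendsto (fun x : ℝ => x * A1) (𝓝[>] 0) (𝓝 (0 * A1)) :=
        (Continuous.tendsto (by fun_prop) 0).mono_left nhdsWithin_le_nhds
      simpa using this
    filter_upwards [h1.eventually_lt_const (show 0 < ε / (2 * (n + 2)) by positivity),
      hb.near_zero (ε / (2 * (n + 2))) (by positivity), self_mem_nhdsWithin] with x hx1 hx2 hx0
    have hx0' : 0 < x := hx0
    have heq := (hreg (n + 2) hn).eq_of_lt n (by omega) x hx0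
    set D := boundaryBound η n
    have h2 : s * |iteratedDeriv (n + 2) f x| ≤ D + η n + ε / (n + 2) := by
      have h3 := abs_add_le (x * iteratedDeriv (n + 1) f x)
        ((2 * s - 2 + n) * iteratedDeriv n f x + steinRhs s h n x)
      rw [← add_assoc, ← heq, abs_mul, abs_of_pos hs0, abs_mul, abs_of_pos hx0'] at h3
      have h4 : x * |iteratedDeriv (n + 1) f x| ≤ x * A1 :=
        mul_le_mul_of_nonneg_left (hA1 x hx0') hx0'.le
      have h5 : ε / (n + 2) = ε / (2 * (n + 2)) + ε / (2 * (n + 2)) := by field_simp; norm_num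
      linarith
    -- The new coefficient is 2s + n, at most (n+2)s because s ≥ 1. This removes s from the boundary
    -- recursion.
    have h6 : (2 * s - 2 + ((n + 2 : ℕ) : ℝ)) ≤ (n + 2) * s := by
      push_cast
      nlinarith [Nat.cast_nonneg (α := ℝ) n]
    calc _ ≤ (n + 2) * s * |iteratedDeriv (n + 2) f x| :=
          mul_le_mul_of_nonneg_right h6 (abs_nonneg _)
      _ = (n + 2) * (s * |iteratedDeriv (n + 2) f x|) := by ring
      _ ≤ (n + 2) * (D + η n + ε / (n + 2)) := by gcongr
      _ = boundaryBound η (n + 2) + ε := by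
          rw [boundaryBound]
          field_simp
          ring

end Bounds

/-! ### The claimed sums as recursions. -/

/-- Bounds for the derivatives of order `n + 1`, in recursive form. -/
def firstBound (η : ℕ → ℝ) : ℕ → ℝ
  | 0 => √(2 * Real.pi) * η 0
  | n + 1 => √(2 * Real.pi) * (η (n + 1) + (n + 1) * firstBound η n)

/-- Bounds for the derivatives of order `2k + 1`, in recursive form. -/
def oddBound (C : ℝ) (η : ℕ → ℝ) : ℕ → ℝ
  | 0 => √(2 * Real.pi) * η 0
  | k + 1 => C * (η (2 * k + 1) + (2 * k + 1) * oddBound C η k)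

/-- Bounds for the derivatives of order `2k`, in recursive form. -/
def evenBound (C : ℝ) (η : ℕ → ℝ) : ℕ → ℝ
  | 0 => 0
  | k + 1 => C * (2 * k + 2) * (C * η (2 * k) + evenBound C η k)

lemma firstBound_eq (η : ℕ → ℝ) (n : ℕ) : firstBound η n =
    (n ! : ℝ) * ∑ j ∈ Finset.range (n + 1),
      (2 * Real.pi) ^ ((((n + 1 : ℕ) : ℝ) - (j : ℝ)) / 2) / (j ! : ℝ) * η j := by
  have hpi : (0 : ℝ) < 2 * Real.pi := by positivity
  induction n with
  | zero => simp [firstBound, Real.sqrt_eq_rpow]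
  | succ n ih =>
    have h1 : ∑ j ∈ Finset.range (n + 1),
        (2 * Real.pi) ^ ((((n + 1 + 1 : ℕ) : ℝ) - (j : ℝ)) / 2) / (j ! : ℝ) * η j =
        √(2 * Real.pi) * ∑ j ∈ Finset.range (n + 1),
        (2 * Real.pi) ^ ((((n + 1 : ℕ) : ℝ) - (j : ℝ)) / 2) / (j ! : ℝ) * η j := by
      rw [Finset.mul_sum]
      refine Finset.sum_congr rfl fun j _ => ?_
      have : (((n + 1 + 1 : ℕ) : ℝ) - (j : ℝ)) / 2 =
          1 / 2 + (((n + 1 : ℕ) : ℝ) - (j : ℝ)) / 2 := by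
        push_cast
        ring
      rw [this, Real.rpow_add hpi, ← Real.sqrt_eq_rpow]
      ring
    have h2 : (((n + 1 + 1 : ℕ) : ℝ) - ((n + 1 : ℕ) : ℝ)) / 2 = 1 / 2 := by
      push_cast
      ring
    have h3 : ((n + 1)! : ℝ) ≠ 0 := by positivity
    rw [firstBound, ih, Finset.sum_range_succ _ (n + 1), h1, h2, ← Real.sqrt_eq_rpow,
      mul_add ((n + 1)! : ℝ), div_mul_eq_mul_div, mul_div_cancel₀ _ h3, Nat.factorial_succ]
    push_cast
    ring

lemma oddBound_eq (C : ℝ) (η : ℕ → ℝ) (k : ℕ) : oddBound C η k =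
    √(2 * Real.pi) * C ^ k * ((2 * k - 1)‼ : ℝ) * η 0 +
      ∑ j ∈ Finset.Icc 1 k,
        C ^ (k - j + 1) * (((2 * k - 1)‼ : ℝ) / ((2 * j - 1)‼ : ℝ)) * η (2 * j - 1) := by
  induction k with
  | zero => simp [oddBound]
  | succ k ih =>
    have hdf : ((2 * (k + 1) - 1)‼ : ℝ) = (2 * k + 1) * ((2 * k - 1)‼ : ℝ) := by
      -- For k = 0 the subtraction 2·0 - 1 truncates to 0, and 0‼ = 1 is the intended value of
      -- (-1)‼.
      cases k with
      | zero => simp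
      | succ k =>
        rw [show 2 * (k + 1 + 1) - 1 = (2 * (k + 1) - 1) + 2 by omega,
          Nat.doubleFactorial_add_two]
        push_cast [show 2 * (k + 1) - 1 = 2 * k + 1 by omega]
        ring
    have h0 : ((2 * (k + 1) - 1)‼ : ℝ) ≠ 0 := by
      exact_mod_cast (Nat.doubleFactorial_pos _).ne'
    have h1 : ∑ j ∈ Finset.Icc 1 k, C ^ (k + 1 - j + 1) *
        (((2 * (k + 1) - 1)‼ : ℝ) / ((2 * j - 1)‼ : ℝ)) * η (2 * j - 1) =
        C * (2 * k + 1) * ∑ j ∈ Finset.Icc 1 k,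
          C ^ (k - j + 1) * (((2 * k - 1)‼ : ℝ) / ((2 * j - 1)‼ : ℝ)) * η (2 * j - 1) := by
      rw [Finset.mul_sum]
      refine Finset.sum_congr rfl fun j hj => ?_
      rw [hdf, show k + 1 - j + 1 = (k - j + 1) + 1 by have := (Finset.mem_Icc.1 hj).2; omega]
      ring
    rw [Finset.sum_Icc_succ_top (by omega), h1, div_self h0, hdf, oddBound, ih,
      show k + 1 - (k + 1) + 1 = 1 by omega, show 2 * (k + 1) - 1 = 2 * k + 1 by omega]
    ring

lemma evenBound_eq (C : ℝ) (η : ℕ → ℝ) (k : ℕ) : evenBound C η k =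
    ∑ j ∈ Finset.range k,
      C ^ (k - j + 1) * (((2 * k)‼ : ℝ) / ((2 * j)‼ : ℝ)) * η (2 * j) := by
  induction k with
  | zero => simp [evenBound]
  | succ k ih =>
    have hdf : ((2 * (k + 1))‼ : ℝ) = (2 * k + 2) * ((2 * k)‼ : ℝ) := by
      rw [show 2 * (k + 1) = 2 * k + 2 by ring, Nat.doubleFactorial_add_two]
      push_cast
      ring
    have h0 : ((2 * k)‼ : ℝ) ≠ 0 := by
      exact_mod_cast (Nat.doubleFactorial_pos _).ne'
    have h1 : ∑ j ∈ Finset.range k, C ^ (k + 1 - j + 1) *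
        (((2 * (k + 1))‼ : ℝ) / ((2 * j)‼ : ℝ)) * η (2 * j) =
        C * (2 * k + 2) * ∑ j ∈ Finset.range k,
          C ^ (k - j + 1) * (((2 * k)‼ : ℝ) / ((2 * j)‼ : ℝ)) * η (2 * j) := by
      rw [Finset.mul_sum]
      refine Finset.sum_congr rfl fun j hj => ?_
      rw [hdf, show k + 1 - j + 1 = (k - j + 1) + 1 by have := Finset.mem_range.1 hj; omega]
      ring
    rw [Finset.sum_range_succ, h1, hdf, mul_div_assoc, div_self h0, evenBound, ih,
      show k + 1 - k + 1 = 2 by omega]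
    ring

/-! ### The boundary recursion is dominated by the claimed sums. -/

section Comparison

variable {η : ℕ → ℝ}

lemma firstBound_nonneg (hη : ∀ n, 0 ≤ η n) (n : ℕ) : 0 ≤ firstBound η n := by
  induction n with
  | zero => exact mul_nonneg (Real.sqrt_nonneg _) (hη 0)
  | succ n ih =>
    have := hη (n + 1)
    rw [firstBound]
    positivity

lemma oddBound_nonneg {C : ℝ} (hC : 0 ≤ C) (hη : ∀ n, 0 ≤ η n) (k : ℕ) : 0 ≤ oddBound C η k := by
  induction k with
  | zero => exact mul_nonneg (Real.sqrt_nonneg _) (hη 0)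
  | succ k ih =>
    have := hη (2 * k + 1)
    rw [oddBound]
    positivity

lemma evenBound_nonneg {C : ℝ} (hC : 0 ≤ C) (hη : ∀ n, 0 ≤ η n) (k : ℕ) :
    0 ≤ evenBound C η k := by
  induction k with
  | zero => exact le_rfl
  | succ k ih =>
    have := hη (2 * k)
    rw [evenBound]
    positivity

/-- One step of the boundary recursion raises the order by two, so it is compared with two steps of
`firstBound`, which together gain the ample factor 2π(n+2). -/
lemma boundaryBound_le_firstBound (hη : ∀ n, 0 ≤ η n) (n : ℕ) :
    boundaryBound η (n + 1) ≤ 2 * (n + 1) * firstBound η n := by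
  have hpi := Real.pi_gt_three
  have hsq : √(2 * Real.pi) * √(2 * Real.pi) = 2 * Real.pi := Real.mul_self_sqrt (by positivity)
  induction n using Nat.twoStepInduction with
  | zero =>
    have := firstBound_nonneg hη 0
    simp only [boundaryBound]
    positivity
  | one =>
    have h0 := hη 0
    have h1 := mul_nonneg (Real.sqrt_nonneg (2 * Real.pi)) (hη 1)
    have h2 : firstBound η 1 = √(2 * Real.pi) * η 1 + 2 * Real.pi * η 0 := by
      rw [firstBound, firstBound]
      push_cast
      linear_combination η 0 * hsq
    rw [h2]
    simp only [boundaryBound]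
    push_cast
    nlinarith
  | more n ih _ =>
    have hb := firstBound_nonneg hη n
    have h1 := hη (n + 1)
    have h2 := mul_nonneg (Real.sqrt_nonneg (2 * Real.pi)) (hη (n + 2))
    have hn : (0 : ℝ) ≤ n := Nat.cast_nonneg n
    set X : ℝ := η (n + 1) + (n + 1) * firstBound η n with hX
    have hX0 : 0 ≤ X := by positivity
    have h3 : firstBound η (n + 2) =
        √(2 * Real.pi) * η (n + 2) + 2 * Real.pi * (n + 2) * X := by
      rw [firstBound, firstBound, hX]
      push_cast
      linear_combination (n + 2) * (η (n + 1) + (n + 1) * firstBound η n) * hsq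
    have h4 : X ≤ firstBound η (n + 2) := by
      have : X ≤ 2 * Real.pi * (n + 2) * X := le_mul_of_one_le_left hX0 (by nlinarith)
      linarith
    rw [show n + 2 + 1 = (n + 1) + 2 by ring, boundaryBound]
    push_cast
    calc _ ≤ ((n : ℝ) + 1 + 2) * (2 * X) := by
          refine mul_le_mul_of_nonneg_left ?_ (by positivity)
          linarith
      _ ≤ ((n : ℝ) + 1 + 2) * (2 * firstBound η (n + 2)) := by gcongr
      _ = _ := by ring

/-- Odd boundary values start from 0, since f'(0+) = 0. The two recursions then have the same shape
up to the factor C ≥ 1. -/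
lemma boundaryBound_le_oddBound {C : ℝ} (hC : 1 ≤ C) (hη : ∀ n, 0 ≤ η n) (k : ℕ) :
    boundaryBound η (2 * k + 1) ≤ (2 * k + 1) * oddBound C η k := by
  induction k with
  | zero =>
    have := oddBound_nonneg (by linarith : 0 ≤ C) hη 0
    simp only [boundaryBound]
    positivity
  | succ k ih =>
    have h1 := oddBound_nonneg (by linarith : 0 ≤ C) hη k
    have h2 := hη (2 * k + 1)
    rw [show 2 * (k + 1) + 1 = (2 * k + 1) + 2 by ring, boundaryBound, oddBound]
    push_cast
    calc _ ≤ (2 * (k : ℝ) + 1 + 2) * (η (2 * k + 1) + (2 * k + 1) * oddBound C η k) := by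
          refine mul_le_mul_of_nonneg_left ?_ (by positivity)
          linarith
      _ ≤ (2 * (k : ℝ) + 1 + 2) * (C * (η (2 * k + 1) + (2 * k + 1) * oddBound C η k)) := by
          refine mul_le_mul_of_nonneg_left ?_ (by positivity)
          exact le_mul_of_one_le_left (by positivity) hC
      _ = _ := by ring

/-- The comparison fails in general at order 0, where the boundary bound is η_0 and the sum is
empty, so it starts at order 2: there 4η_0 ≤ 2C²η_0. -/
lemma boundaryBound_le_evenBound {C : ℝ} (hC : 2 ≤ C) (hη : ∀ n, 0 ≤ η n) (k : ℕ) :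
    boundaryBound η (2 * k + 2) ≤ evenBound C η (k + 1) := by
  induction k with
  | zero =>
    have h0 := hη 0
    simp only [mul_zero, boundaryBound, evenBound]
    push_cast
    nlinarith [mul_nonneg (by nlinarith : 0 ≤ C * C - 2) h0]
  | succ k ih =>
    have h1 := evenBound_nonneg (by linarith : 0 ≤ C) hη (k + 1)
    have h2 := hη (2 * k + 2)
    rw [show 2 * (k + 1) + 2 = (2 * k + 2) + 2 by ring, boundaryBound, evenBound,
      show 2 * (k + 1) = 2 * k + 2 by ring]
    push_cast
    calc _ ≤ (2 * (k : ℝ) + 2 + 2) * (C * η (2 * k + 2) + evenBound C η (k + 1)) := by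
          refine mul_le_mul_of_nonneg_left ?_ (by positivity)
          nlinarith
      _ ≤ C * ((2 * (k : ℝ) + 2 + 2) * (C * η (2 * k + 2) + evenBound C η (k + 1))) :=
          le_mul_of_one_le_left (by positivity) (by linarith)
      _ = _ := by ring

end Comparison

/-! ### Derivative bounds for s ≥ 1. -/

section Main

variable {s : ℝ} {h : ℝ → ℝ}

lemma constC_of_one_le (hs : 1 ≤ s) : constC s = 2 * (√(Real.pi * s) + 1 / s) := by
  rw [constC, if_neg (by intro h; linarith)]

/-- Only these two properties of C are used for s ≥ 1: 4/s is the constant obtained from 2r/s, and C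
≥ 2 feeds the comparison of recursions. -/
lemma two_le_constC (hs : 1 ≤ s) : 2 ≤ constC s ∧ 4 / s ≤ constC s := by
  have h1 : 1 ≤ √(Real.pi * s) := Real.one_le_sqrt.2 (by nlinarith [Real.pi_gt_three])
  have h2 : 1 / s ≤ 1 := by rw [div_le_one (by linarith)]; exact hs
  have h3 : 0 < 1 / s := by positivity
  rw [constC_of_one_le hs]
  constructor
  · linarith
  · rw [show 4 / s = 4 * (1 / s) by ring]
    linarith

/-- Bound for the derivative of order `n + 1`, `s ≥ 1`. -/
theorem abs_iteratedDeriv_succ_le (hs : 1 ≤ s) {n : ℕ} (hh : MemCb n h) {x : ℝ} (hx : 0 < x) :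
    |iteratedDeriv (n + 1) (steinSol s h) x| ≤
      firstBound (fun j => supNorm (iteratedDeriv j h)) n := by
  have hs0 : 0 < s := by linarith
  obtain ⟨hreg, hb⟩ := steinBounds hs hh le_rfl
  set η : ℕ → ℝ := fun j => supNorm (iteratedDeriv j h)
  have hη : ∀ n, 0 ≤ η n := fun n => supNorm_nonneg _
  obtain ⟨A, B, hAB⟩ := hb.growth
  refine (hreg.abs_le hs0 hb.abs_le hAB hx).1.trans ?_
  -- Here max(η, D) ≤ η + D, and D is absorbed by the previous bound; at order 0 one has D = η_0, so
  -- the maximum adds nothing.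
  have hmax : η n + max (η n) (boundaryBound η n) ≤
      2 * (η n + n * if n = 0 then 0 else firstBound η (n - 1)) := by
    cases n with
    | zero => simp [boundaryBound, two_mul]
    | succ n =>
      have h1 := boundaryBound_le_firstBound hη n
      have h2 : max (η (n + 1)) (boundaryBound η (n + 1)) ≤
          η (n + 1) + boundaryBound η (n + 1) :=
        max_le_add_of_nonneg (hη _) (boundaryBound_nonneg hη _)
      simp only [Nat.add_eq_zero_iff, one_ne_zero, and_false, if_false, Nat.add_sub_cancel]
      push_cast
      linarith
  have hfirst : firstBound η n =
      √(2 * Real.pi) * (η n + n * if n = 0 then 0 else firstBound η (n - 1)) := by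
    cases n <;> simp [firstBound]
  -- Since √s ≤ s for s ≥ 1, the dependence on s cancels from the Mills bound.
  have hsqrt : √(2 * Real.pi * s) ≤ √(2 * Real.pi) * s := by
    rw [Real.sqrt_mul (by positivity)]
    refine mul_le_mul_of_nonneg_left ?_ (Real.sqrt_nonneg _)
    rw [Real.sqrt_le_left hs0.le]
    nlinarith
  set r := η n + max (η n) (boundaryBound η n)
  have hr : 0 ≤ r := add_nonneg (hη n) ((hη n).trans (le_max_left _ _))
  calc r / s * (√(2 * Real.pi * s) / 2) ≤ r / s * (√(2 * Real.pi) * s / 2) := by gcongr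
    _ = √(2 * Real.pi) * (r / 2) := by field_simp
    _ ≤ firstBound η n := by
        rw [hfirst]
        refine mul_le_mul_of_nonneg_left ?_ (Real.sqrt_nonneg _)
        linarith

/-- Bound for the derivative of order `n + 2` in terms of the boundary bound, `s ≥ 1`. -/
lemma abs_iteratedDeriv_add_two_le (hs : 1 ≤ s) {n : ℕ} (hh : MemCb n h) {x : ℝ} (hx : 0 < x) :
    |iteratedDeriv (n + 2) (steinSol s h) x| ≤
      constC s * (supNorm (iteratedDeriv n h) +
        if n = 0 then 0 else boundaryBound (fun j => supNorm (iteratedDeriv j h)) n) := by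
  have hs0 : 0 < s := by linarith
  obtain ⟨hreg, hb⟩ := steinBounds hs hh le_rfl
  set η : ℕ → ℝ := fun j => supNorm (iteratedDeriv j h)
  have hη : ∀ n, 0 ≤ η n := fun n => supNorm_nonneg _
  obtain ⟨A, B, hAB⟩ := hb.growth
  refine (hreg.abs_le hs0 hb.abs_le hAB hx).2.trans ?_
  have hD := boundaryBound_nonneg hη n
  set D' : ℝ := if n = 0 then 0 else boundaryBound η n with hD'
  have hD0 : 0 ≤ D' := by
    rw [hD']
    split_ifs
    exacts [le_rfl, hD]
  -- At n = 0 the maximum is η_0 itself, so no boundary term is added; this matches the empty sum in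
  -- the even recursion.
  have hmax : max (η n) (boundaryBound η n) ≤ η n + D' := by
    rw [hD']
    split_ifs with hn
    · subst hn
      simp [boundaryBound]
    · exact max_le_add_of_nonneg (hη n) hD
  have hηn : 0 ≤ η n := hη n
  calc _ ≤ 2 * (η n + (η n + D')) / s := by gcongr
    _ ≤ 4 / s * (η n + D') := by
        rw [div_mul_eq_mul_div]
        exact div_le_div_of_nonneg_right (by linarith) hs0.le
    _ ≤ constC s * (η n + D') :=
        mul_le_mul_of_nonneg_right (two_le_constC hs).2 (by positivity)

lemma abs_iteratedDeriv_odd_le_of_one_le (hs : 1 ≤ s) {k : ℕ} (hh : MemCb (2 * k + 1) h) {x : ℝ}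
    (hx : 0 < x) : |iteratedDeriv (2 * k + 3) (steinSol s h) x| ≤
      oddBound (constC s) (fun j => supNorm (iteratedDeriv j h)) (k + 1) := by
  have hC := (two_le_constC hs).1
  refine (abs_iteratedDeriv_add_two_le hs hh hx).trans ?_
  rw [oddBound, if_neg (by omega)]
  refine mul_le_mul_of_nonneg_left ?_ (by linarith)
  have := boundaryBound_le_oddBound (C := constC s) (by linarith)
    (fun n => supNorm_nonneg (iteratedDeriv n h)) k
  linarith

lemma abs_iteratedDeriv_even_le_of_one_le (hs : 1 ≤ s) {k : ℕ} (hh : MemCb (2 * k) h) {x : ℝ}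
    (hx : 0 < x) : |iteratedDeriv (2 * k + 2) (steinSol s h) x| ≤
      evenBound (constC s) (fun j => supNorm (iteratedDeriv j h)) (k + 1) := by
  have hC := (two_le_constC hs).1
  have hη : ∀ n, 0 ≤ supNorm (iteratedDeriv n h) := fun n => supNorm_nonneg _
  refine (abs_iteratedDeriv_add_two_le hs hh hx).trans ?_
  have hb := evenBound_nonneg (C := constC s) (by linarith) hη k
  have h0 := hη (2 * k)
  rw [evenBound, mul_assoc]
  refine mul_le_mul_of_nonneg_left ?_ (by linarith)
  have h1 : (if 2 * k = 0 then 0 else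
      boundaryBound (fun j => supNorm (iteratedDeriv j h)) (2 * k)) ≤
      evenBound (constC s) (fun j => supNorm (iteratedDeriv j h)) k := by
    cases k with
    | zero => simpa using hb
    | succ k =>
      rw [if_neg (by omega)]
      exact boundaryBound_le_evenBound hC hη k
  have h2 : supNorm (iteratedDeriv (2 * k) h) ≤
      constC s * supNorm (iteratedDeriv (2 * k) h) :=
    le_mul_of_one_le_left h0 (by linarith)
  refine (add_le_add h2 h1).trans (le_mul_of_one_le_left (by positivity) ?_)
  linarith [Nat.cast_nonneg (α := ℝ) k]

/-! ### Derivative bounds for s = 1/2. -/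

lemma steinRegular_half {m : ℕ} (hh : MemCb m h) :
    SteinRegular (1 / 2) h (steinSol (1 / 2) h) m ∧
      ∀ x, 0 < x → |iteratedDeriv 2 (steinSol (1 / 2) h) x| ≤ 8 * supNorm (iteratedDeriv 0 h) := by
  have hM : ∀ x, 0 < x → |h x| ≤ supNorm (iteratedDeriv 0 h) := fun x hx => by
    have := hh.abs_le_supNorm (Nat.zero_le m) hx
    rwa [iteratedDeriv_zero] at this ⊢
  obtain ⟨u, hu, hac, hode, hb⟩ := steinSol_half (hh.mono (Nat.zero_le m)).1 hM
  refine ⟨(SteinRegular.base hu hac hode).of_memCb (by norm_num) hh, fun x hx => ?_⟩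
  have hu1 : ∀ x, 0 < x → u x = iteratedDeriv 1 (steinSol (1 / 2) h) x := fun x hx => by
    rw [iteratedDeriv_one, (hu x hx).deriv]
  rw [iteratedDeriv_succ, ← (eventuallyEq_of_eq_on_pos hu1 hx).deriv_eq]
  exact hac.abs_deriv_le hb hx

lemma constC_half : constC (1 / 2) = 4 := if_pos rfl

/-- The inductive step for `s = 1/2`. -/
lemma abs_iteratedDeriv_half_step {n : ℕ} (hn : n ≠ 0) (hh : MemCb n h) {b : ℝ}
    (hb : ∀ x, 0 < x → (n - 1) * |iteratedDeriv n (steinSol (1 / 2) h) x| ≤ b)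
    (hgrow : ∃ A B : ℝ, ∀ x, 0 < x → |iteratedDeriv n (steinSol (1 / 2) h) x| ≤ A + B * x)
    {x : ℝ} (hx : 0 < x) :
    |iteratedDeriv (n + 2) (steinSol (1 / 2) h) x| ≤ 4 * (supNorm (iteratedDeriv n h) + b) := by
  have hreg := (steinRegular_half hh).1
  obtain ⟨A, B, hAB⟩ := hgrow
  have hn1 : (1 : ℝ) ≤ n := by exact_mod_cast Nat.one_le_iff_ne_zero.2 hn
  refine (hreg.abs_le (r := supNorm (iteratedDeriv n h) + b) (by norm_num) ?_ hAB hx).2.trans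
    (le_of_eq (by ring))
  filter_upwards [hreg.ae_eq] with y hy hy0
  have h1 : 1 / 2 * iteratedDeriv (n + 2) (steinSol (1 / 2) h) y -
      y * iteratedDeriv (n + 1) (steinSol (1 / 2) h) y =
      iteratedDeriv n h y + (n - 1) * iteratedDeriv n (steinSol (1 / 2) h) y := by
    rw [hy hy0, steinRhs_of_pos _ _ hn]
    ring
  rw [h1]
  refine (abs_add_le _ _).trans (add_le_add (hh.abs_le_supNorm le_rfl hy0) ?_)
  rw [abs_mul, abs_of_nonneg (by linarith)]
  exact hb y hy0

/-- The induction goes straight from f^{(2k+2)} to f^{(2k+4)}, the residual being h^{(2k+2)} +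
(2k+1) f^{(2k+2)}. It starts from |f''| ≤ 8‖h‖. -/
lemma abs_iteratedDeriv_even_le_half {k : ℕ} (hh : MemCb (2 * k) h) {x : ℝ}
    (hx : 0 < x) : |iteratedDeriv (2 * k + 2) (steinSol (1 / 2) h) x| ≤
      evenBound (constC (1 / 2)) (fun j => supNorm (iteratedDeriv j h)) (k + 1) := by
  have hη : ∀ n, 0 ≤ supNorm (iteratedDeriv n h) := fun n => supNorm_nonneg _
  rw [constC_half]
  induction k generalizing x with
  | zero =>
    have h0 := hη 0
    refine ((steinRegular_half hh).2 x hx).trans ?_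
    simp only [evenBound, mul_zero]
    push_cast
    linarith
  | succ k ih =>
    have hb := fun y (hy : 0 < y) => ih (hh.mono (by omega)) hy
    set b := evenBound 4 (fun j => supNorm (iteratedDeriv j h)) (k + 1) with hbdef
    have hk : (0 : ℝ) ≤ k := Nat.cast_nonneg k
    have hb0 : 0 ≤ b := evenBound_nonneg (by norm_num) hη (k + 1)
    have h0 := hη (2 * (k + 1))
    have := abs_iteratedDeriv_half_step (n := 2 * (k + 1)) (b := (2 * k + 1) * b) (by omega) hh
      (fun y hy => by
        push_cast
        rw [show (2 * ((k : ℝ) + 1) - 1) = 2 * k + 1 by ring]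
        exact mul_le_mul_of_nonneg_left (hb y hy) (by positivity))
      ⟨b, 0, fun y hy => by rw [zero_mul, add_zero]; exact hb y hy⟩ hx
    refine this.trans ?_
    rw [evenBound, ← hbdef, mul_assoc]
    refine mul_le_mul_of_nonneg_left ?_ (by norm_num)
    push_cast
    nlinarith [mul_nonneg hk h0]

/-- At n = 1 the coefficient n-1 is 0, so |f'''| ≤ 4‖h'‖ needs no bound on f', only its linear
growth. -/
lemma abs_iteratedDeriv_odd_le_half {k : ℕ} (hh : MemCb (2 * k + 1) h) {x : ℝ}
    (hx : 0 < x) : |iteratedDeriv (2 * k + 3) (steinSol (1 / 2) h) x| ≤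
      oddBound (constC (1 / 2)) (fun j => supNorm (iteratedDeriv j h)) (k + 1) := by
  have hη : ∀ n, 0 ≤ supNorm (iteratedDeriv n h) := fun n => supNorm_nonneg _
  rw [constC_half]
  induction k generalizing x with
  | zero =>
    have h0 := oddBound_nonneg (C := 4) (by norm_num) hη 0
    obtain ⟨hreg, h2⟩ := steinRegular_half hh
    set K := 8 * supNorm (iteratedDeriv 0 h) with hK
    have hK0 : 0 ≤ K := mul_nonneg (by norm_num) (hη 0)
    have hac : LocAC (iteratedDeriv 1 (steinSol (1 / 2) h)) :=
      (steinRegular_half (hh.mono (Nat.zero_le _))).1.locAC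
    -- Linear growth of f' follows by integrating the bound on f'' from the base point 1.
    have hgrow : ∀ y, 0 < y → |iteratedDeriv 1 (steinSol (1 / 2) h) y| ≤
        (|iteratedDeriv 1 (steinSol (1 / 2) h) 1| + K) + K * y := fun y hy => by
      have h3 := hac.abs_sub_le_of_abs_deriv_le (K := K)
        (ae_of_all _ fun t ht => by rw [← iteratedDeriv_succ]; exact h2 t ht) one_pos hy
      have h4 : |y - 1| ≤ y + 1 := abs_le.2 ⟨by linarith, by linarith⟩
      have h5 := mul_le_mul_of_nonneg_left h4 hK0
      have h6 := abs_sub_abs_le_abs_sub (iteratedDeriv 1 (steinSol (1 / 2) h) y)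
        (iteratedDeriv 1 (steinSol (1 / 2) h) 1)
      linarith
    have := abs_iteratedDeriv_half_step (n := 2 * 0 + 1) (b := 0) (by omega) hh
      (fun y _ => by simp) ⟨_, _, hgrow⟩ hx
    refine this.trans ?_
    rw [oddBound]
    push_cast
    linarith
  | succ k ih =>
    have hb := fun y (hy : 0 < y) => ih (hh.mono (by omega)) hy
    set b := oddBound 4 (fun j => supNorm (iteratedDeriv j h)) (k + 1) with hbdef
    have hk : (0 : ℝ) ≤ k := Nat.cast_nonneg k
    have hb0 : 0 ≤ b := oddBound_nonneg (by norm_num) hη (k + 1)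
    have := abs_iteratedDeriv_half_step (n := 2 * (k + 1) + 1) (b := (2 * k + 2) * b) (by omega) hh
      (fun y hy => by
        push_cast
        rw [show (2 * ((k : ℝ) + 1) + 1 - 1) = 2 * k + 2 by ring]
        exact mul_le_mul_of_nonneg_left (hb y hy) (by positivity))
      ⟨b, 0, fun y hy => by rw [zero_mul, add_zero]; exact hb y hy⟩ hx
    refine this.trans ?_
    rw [oddBound, ← hbdef]
    refine mul_le_mul_of_nonneg_left ?_ (by norm_num)
    push_cast
    nlinarith

lemma steinRegular_steinSol (hs : s = 1 / 2 ∨ 1 ≤ s) {m : ℕ} (hh : MemCb m h) :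
    SteinRegular s h (steinSol s h) m := by
  rcases hs with rfl | hs
  · exact (steinRegular_half hh).1
  · exact (steinBounds hs hh le_rfl).1

end Main

end PRR

end

/-! ### Assembly of the recursive bounds in closed form. -/

theorem mainTheorem9 (s : ℝ) (hs : s = 1 / 2 ∨ 1 ≤ s) (h : ℝ → ℝ) :
    -- `f = steinSol s h` solves the Stein equation
    (PRR.MemCb 0 h → ∀ᵐ x ∂(volume.restrict (Ioi (0 : ℝ))),
      PRR.steinOp s (PRR.steinSol s h) x = h x - PRR.mean s h) ∧
    -- bounds on the derivative of order `n ≥ 1`, for `s ≥ 1`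
    (1 ≤ s → ∀ n : ℕ, 1 ≤ n → PRR.MemCb (n - 1) h →
      (∀ j < n, DifferentiableOn ℝ (iteratedDeriv j (PRR.steinSol s h)) (Ioi 0)) ∧
      ∀ x ∈ Ioi (0 : ℝ), |iteratedDeriv n (PRR.steinSol s h) x| ≤
        ((n - 1)! : ℝ) * ∑ j ∈ Finset.range n,
          (2 * Real.pi) ^ (((n : ℝ) - (j : ℝ)) / 2) / (j ! : ℝ) *
            PRR.supNorm (iteratedDeriv j h)) ∧
    -- bounds on the derivative of odd order `2k + 1 ≥ 3`
    (∀ k : ℕ, 1 ≤ k → PRR.MemCb (2 * k - 1) h →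
      PRR.HasACDeriv (2 * k + 1) (PRR.steinSol s h) ∧
      ∀ x ∈ Ioi (0 : ℝ), |iteratedDeriv (2 * k + 1) (PRR.steinSol s h) x| ≤
        √(2 * Real.pi) * PRR.constC s ^ k * ((2 * k - 1)‼ : ℝ) * PRR.supNorm h +
        ∑ j ∈ Finset.Icc 1 k,
          PRR.constC s ^ (k - j + 1) * (((2 * k - 1)‼ : ℝ) / ((2 * j - 1)‼ : ℝ)) *
            PRR.supNorm (iteratedDeriv (2 * j - 1) h)) ∧
    -- bounds on the derivative of even order `2k ≥ 2`
    (∀ k : ℕ, 1 ≤ k → PRR.MemCb (2 * k - 2) h →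
      PRR.HasACDeriv (2 * k) (PRR.steinSol s h) ∧
      ∀ x ∈ Ioi (0 : ℝ), |iteratedDeriv (2 * k) (PRR.steinSol s h) x| ≤
        ∑ j ∈ Finset.range k,
          PRR.constC s ^ (k - j + 1) * (((2 * k)‼ : ℝ) / ((2 * j)‼ : ℝ)) *
            PRR.supNorm (iteratedDeriv (2 * j) h)) := by
  refine ⟨fun hh => ?_, fun hs1 n hn hh => ?_, fun k hk hh => ?_, fun k hk hh => ?_⟩
  · rw [ae_restrict_iff' measurableSet_Ioi]
    filter_upwards [(PRR.steinRegular_steinSol hs hh).ae_eq] with x hx hx0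
    have h1 := hx hx0
    rw [PRR.steinRhs_zero, iteratedDeriv_zero, zero_add, zero_add, iteratedDeriv_one] at h1
    push_cast at h1
    rw [PRR.steinOp]
    linarith
  · obtain ⟨n, rfl⟩ := Nat.exists_eq_succ_of_ne_zero (Nat.one_le_iff_ne_zero.1 hn)
    simp only [Nat.succ_eq_add_one, Nat.add_sub_cancel] at hh ⊢
    refine ⟨fun j hj x hx => ((PRR.steinRegular_steinSol hs hh).hasDerivAt j (by omega)
      x hx).differentiableAt.differentiableWithinAt, fun x hx => ?_⟩
    have := PRR.abs_iteratedDeriv_succ_le hs1 hh hx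
    rwa [PRR.firstBound_eq] at this
  · obtain ⟨k, rfl⟩ := Nat.exists_eq_succ_of_ne_zero (Nat.one_le_iff_ne_zero.1 hk)
    simp only [Nat.succ_eq_add_one] at hh ⊢
    rw [show 2 * (k + 1) - 1 = 2 * k + 1 by omega] at hh
    refine ⟨(PRR.steinRegular_steinSol hs hh).hasACDeriv, fun x hx => ?_⟩
    have h1 : |iteratedDeriv (2 * k + 3) (PRR.steinSol s h) x| ≤
        PRR.oddBound (PRR.constC s) (fun j => PRR.supNorm (iteratedDeriv j h)) (k + 1) := by
      rcases hs with rfl | hs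
      · exact PRR.abs_iteratedDeriv_odd_le_half hh hx
      · exact PRR.abs_iteratedDeriv_odd_le_of_one_le hs hh hx
    rw [PRR.oddBound_eq, iteratedDeriv_zero] at h1
    exact h1
  · obtain ⟨k, rfl⟩ := Nat.exists_eq_succ_of_ne_zero (Nat.one_le_iff_ne_zero.1 hk)
    simp only [Nat.succ_eq_add_one] at hh ⊢
    rw [show 2 * (k + 1) - 2 = 2 * k by omega] at hh
    refine ⟨(PRR.steinRegular_steinSol hs hh).hasACDeriv, fun x hx => ?_⟩
    have h1 : |iteratedDeriv (2 * k + 2) (PRR.steinSol s h) x| ≤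
        PRR.evenBound (PRR.constC s) (fun j => PRR.supNorm (iteratedDeriv j h)) (k + 1) := by
      rcases hs with rfl | hs
      · exact PRR.abs_iteratedDeriv_even_le_half hh hx
      · exact PRR.abs_iteratedDeriv_even_le_of_one_le hs hh hx
    rw [PRR.evenBound_eq] at h1
    exact h1
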